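/- Let $\mathbb T^N=\mathbb R^N/\mathbb Z^N$ and $m\ge 1$. For $i=1,\dots,m$ let $H_i:\mathbb T^N\times\mathbb R^N\to\mathbb R$ be continuous, convex in $p\in\mathbb R^N$ for every $x\in\mathbb T^N$, and such that $\alpha_i(|p|)\le H_i(x,p)\le\beta_i(|p|)$ for all $(x,p)$, for some functions $\alpha_i,\beta_i:[0,\infty)\to\mathbb R$ tending to $+\infty$ at $+\infty$. Let $B(x)=(b_{ij}(x))$ be an $m\times m$ real matrix depending continuously on $x\in\mathbb T^N$ and such that, for every $x$: $b_{ij}(x)\le 0$ for $j\ne i$; $\sum_{j=1}^m b_{ij}(x)=0$ for every $i$; and $B(x)$ is irreducible, i.e. for every nonempty proper subset $I\subsetneq\{1,\dots,m\}$ there are $i\in I$ and $j\notin I$ with $b_{ij}(x)\neq 0$. For $a\in\mathbb R$, let $\mathcal H(a)$ be the set of viscosity subsolutions of $$H_i(x,Du_i)+(B(x)\mathbf u(x))_i=a\ \text{ in }\mathbb T^N,\qquad i=1,\dots,m,$$ that is, of the continuous $\mathbf u=(u_1,\dots,u_m):\mathbb T^N\to\mathbb R^m$ such that $H_i(x,p)+(B(x)\mathbf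 u(x))_i\le a$ for all $x$, all $i$ and all $p$ in the superdifferential $D^+u_i(x)$. Here $D^+u_i(x)$ (resp. $D^-u_i(x)$) is the set of the gradients $D\phi(x)$ of the functions $\phi$ of class $C^1$ near $x$ such that $u_i-\phi$ has a local maximum (resp. minimum) at $x$. Viscosity supersolutions are the continuous $\mathbf u$ such that $H_i(x,p)+(B(x)\mathbf u(x))_i\ge a$ for all $x$, all $i$ and all $p\in D^-u_i(x)$; viscosity solutions are the functions that are both subsolutions and supersolutions. Assume that the critical value $c=\inf\{a\in\mathbb R:\mathcal H(a)\ne\varnothing\}$ is equal to $0$. The elements of $\mathcal H(0)$ are called critical subsolutions, and the solutions of the system with $a=0$ critical solutions. For $i,j\in\{1,\dots,m\}$ and $x,y\in\mathbb T^N$ put $\Phi_{i,j}(y,x)=\sup_{\mathbf v\in\mathcal H(0)}\big(v_i(x)-v_j(y)\big)$. Fix any index $i_0\in\{1,\dots,m\}$ and let the Aubry set $\mathcal A$ be the set of the points $y\in\mathbb T^N$ such that $\Phi_{\cdot,i_0}(y,\cdot)$ is a critical solution. For $\mathbf v\in\mathcal H(0)$, the component $v_i$ is said to be strict at $y$ if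 there are an open neighbourhood $V$ of $y$ and $\delta>0$ such that, for a.e. $x\in V$, $v_i$ is differentiable at $x$ and $H_i(x,Dv_i(x))+(B(x)\mathbf v(x))_i<-\delta$; and $\mathbf v$ is said to be strict at $y$ if $v_i$ is strict at $y$ for every $i\in\{1,\dots,m\}$. Then, for every $y\in\mathbb T^N$ and whatever the choice of $i_0$, the following are equivalent: (i) $y\notin\mathcal A$; (ii) there exists $\mathbf w\in\mathcal H(0)$ which is strict at $y$; (iii) there exist $\mathbf w\in\mathcal H(0)$ and $i\in\{1,\dots,m\}$ such that $w_i$ is strict at $y$. -/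

import Mathlib

open MeasureTheory Filter Topology

namespace WeaklyCoupled

/-- The flat torus `ℝ^N / ℤ^N`. -/
abbrev Torus (N : ℕ) : Type := UnitAddTorus (Fin N)

/-- The space `ℝ^N` with its Euclidean norm. -/
abbrev Euc (N : ℕ) : Type := EuclideanSpace ℝ (Fin N)

/-- The canonical projection `ℝ^N → ℝ^N / ℤ^N`. -/
def proj {N : ℕ} (h : Euc N) : Torus N := fun k => ((h k : ℝ) : UnitAddCircle)

/-- The function `u` on the torus read in the local chart centred at `x`, that is
`h ↦ u (x + h)` with `h ∈ ℝ^N` taken modulo `ℤ^N`. -/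
def inChart {N : ℕ} (u : Torus N → ℝ) (x : Torus N) : Euc N → ℝ := fun h => u (x + proj h)

/-- `u` is differentiable at `x` with `Du(x) = p`. -/
def HasGrad {N : ℕ} (u : Torus N → ℝ) (x : Torus N) (p : Euc N) : Prop :=
  HasGradientAt (inChart u x) p 0

/-- The set `D⁺u(x)` of superdifferentials of `u` at `x`: the gradients at `x` of the functions
`φ` of class `C¹` near `x` such that `u - φ` has a local maximum at `x`. The functions are read in
the chart centred at `x`. -/
def superdiff {N : ℕ} (u : Torus N → ℝ) (x : Torus N) : Set (Euc N) :=
  {p | ∃ φ : Euc N → ℝ, ContDiffAt ℝ 1 φ 0 ∧ IsLocalMax (fun h => inChart u x h - φ h) 0 ∧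
    HasGradientAt φ p 0}

/-- The set `D⁻u(x)` of subdifferentials of `u` at `x`: the gradients at `x` of the functions
`φ` of class `C¹` near `x` such that `u - φ` has a local minimum at `x`. -/
def subdiff {N : ℕ} (u : Torus N → ℝ) (x : Torus N) : Set (Euc N) :=
  {p | ∃ φ : Euc N → ℝ, ContDiffAt ℝ 1 φ 0 ∧ IsLocalMin (fun h => inChart u x h - φ h) 0 ∧
    HasGradientAt φ p 0}

/-- Convex Hamiltonians on the torus: continuous, convex in the momentum, and squeezed between two
coercive functions of `|p|`. -/
structure IsConvexHamiltonian {N : ℕ} (H : Torus N → Euc N → ℝ) : Prop where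
  continuous : Continuous fun z : Torus N × Euc N => H z.1 z.2
  convex : ∀ x, ConvexOn ℝ Set.univ (H x)
  coercive : ∃ α β : ℝ → ℝ, Tendsto α atTop atTop ∧ Tendsto β atTop atTop ∧
    ∀ x p, α ‖p‖ ≤ H x p ∧ H x p ≤ β ‖p‖

/-- Coupling matrices. -/
def IsCoupling {m : ℕ} (B : Matrix (Fin m) (Fin m) ℝ) : Prop :=
  (∀ i j, j ≠ i → B i j ≤ 0) ∧ ∀ i, 0 ≤ ∑ j, B i j

/-- Degeneracy: all row sums vanish. -/
def IsDegenerate {m : ℕ} (B : Matrix (Fin m) (Fin m) ℝ) : Prop :=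
  ∀ i, ∑ j, B i j = 0

/-- Irreducibility: every nonempty proper set `I` of indices is linked to its complement by a
nonzero entry. -/
def IsIrred {m : ℕ} (B : Matrix (Fin m) (Fin m) ℝ) : Prop :=
  ∀ I : Set (Fin m), I.Nonempty → I ≠ Set.univ → ∃ i ∈ I, ∃ j, j ∉ I ∧ B i j ≠ 0

section System

variable {N m : ℕ} (H : Fin m → Torus N → Euc N → ℝ) (B : Torus N → Matrix (Fin m) (Fin m) ℝ)

/-- The quantity `(B(x) u(x))_i = ∑ j, b_ij(x) u_j(x)`. -/
def couple (u : Fin m → Torus N → ℝ) (x : Torus N) (i : Fin m) : ℝ :=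
  ∑ j, B x i j * u j x

/-- The set `𝓗(a)` of (continuous) viscosity subsolutions of the system
`H_i(x, Du_i) + (B(x) u(x))_i = a_i`, `i = 1, …, m`. -/
def subsolutions (a : Fin m → ℝ) : Set (Fin m → Torus N → ℝ) :=
  {u | (∀ i, Continuous (u i)) ∧
    ∀ x i, ∀ p ∈ superdiff (u i) x, H i x p + couple B u x i ≤ a i}

/-- The set of (continuous) viscosity supersolutions of the same system. -/
def supersolutions (a : Fin m → ℝ) : Set (Fin m → Torus N → ℝ) :=
  {u | (∀ i, Continuous (u i)) ∧
    ∀ x i, ∀ p ∈ subdiff (u i) x, a i ≤ H i x p + couple B u x i}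

/-- The set of viscosity solutions of the same system. -/
def solutions (a : Fin m → ℝ) : Set (Fin m → Torus N → ℝ) :=
  subsolutions H B a ∩ supersolutions H B a

/-- `c` is the critical value of the system, i.e. the (finite) infimum of the real numbers `a` such
that the system with right-hand side `(a, …, a)` has a subsolution. -/
def IsCriticalValue (c : ℝ) : Prop :=
  IsGLB {a : ℝ | (subsolutions H B fun _ => a).Nonempty} c

/-- The Mañé matrix `Φ_{i,j}(y, x) = sup {v_i(x) - v_j(y) : v ∈ 𝓗(0)}` (when the critical value is
`0`, this is a supremum over a nonempty set that is bounded above). -/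
noncomputable def mane (i j : Fin m) (y x : Torus N) : ℝ :=
  sSup {r : ℝ | ∃ v ∈ subsolutions H B 0, r = v i x - v j y}

/-- The Aubry set: the points `y` such that `Φ_{·,i}(y, ·)` is a critical solution. The set does not
depend on the fixed index `i` used to define it. -/
def aubry (i : Fin m) : Set (Torus N) :=
  {y | (fun k x => mane H B k i y x) ∈ solutions H B 0}

/-- The `i`-th component of `v` is strict at `y`: for some neighbourhood `V` of `y` and some `δ > 0`
one has `H_i(x, Dv_i(x)) + (B(x) v(x))_i < -δ` for a.e. `x ∈ V`. The existence of the gradient at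
almost every point is part of the requirement. -/
def StrictCompAt (v : Fin m → Torus N → ℝ) (i : Fin m) (y : Torus N) : Prop :=
  ∃ V : Set (Torus N), IsOpen V ∧ y ∈ V ∧ ∃ δ : ℝ, 0 < δ ∧
    ∀ᵐ x ∂(volume : Measure (Torus N)), x ∈ V →
      ∃ p, HasGrad (v i) x p ∧ H i x p + couple B v x i < -δ

/-- `v` is strict at `y`: all of its components are. -/
def StrictAt (v : Fin m → Torus N → ℝ) (y : Torus N) : Prop :=
  ∀ i, StrictCompAt H B v i y

end System

end WeaklyCoupled

namespace WeaklyCoupled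

/-! ### Charts of the torus. -/

variable {N m : ℕ}

/-! Write `U` for the vector `Φ_{·,i₀}(y,·)`. It is the largest critical subsolution normalised by
`U_{i₀}(y) = 0`, and everything rests on this maximality.

Not in the Aubry set gives a strict component: `U` is always a subsolution, so if `y` is outside the
Aubry set the supersolution test fails for some component `k` at some `x`. Perron's construction
(`exists_increase`) then raises `U_k` near `x` within the critical subsolutions. Unless `x = y` and
`k = i₀`, the normalisation survives and maximality is violated. Hence the failure occurs at `y` for
`i₀`, and the raised component is strict there.

One strict component gives all: adding a small bump to a strict `w_i` uses only part of its slack.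
Since `b_ji ≤ 0` off the diagonal, the other inequalities do not get worse, and those with `b_ji(y)
≠ 0` become strict near `y` (`exists_propagate_strict`). Irreducibility spreads strictness to every
index.

Strict excludes the Aubry set: for a critical subsolution `w`, maximality says that `w_k(x) -
U_k(x)` is largest at `k = i₀`, `x = y`. If `U` were a supersolution, it would be touched from below
there by a strict component. As `w` is only Lipschitz, it is first mollified; convexity preserves
strictness (`exists_contDiff_strict`). At the joint maximum the signs and zero row sums of `B`
compare the coupling terms (`not_strict_of_supersolution`).

The supremum defining `U` is tractable because irreducibility bounds the gaps between components of
a subsolution, and coercivity then makes subsolutions equi-Lipschitz (`exists_apriori_bound`).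
Stability (`mem_subsolutions_of_approx`) makes `U` a subsolution and shows that the critical level
is attained. -/

theorem proj_zero : proj (0 : Euc N) = 0 := by
  funext k; simp [proj]

theorem proj_add (h k : Euc N) : proj (h + k) = proj h + proj k := by
  funext i; simp [proj]

theorem continuous_proj : Continuous (proj : Euc N → Torus N) := by
  refine continuous_pi fun k => ?_
  exact (AddCircle.continuous_mk' 1).comp (by fun_prop)

theorem isOpenMap_proj : IsOpenMap (proj : Euc N → Torus N) := by
  have h1 : IsOpenMap (fun (h : Fin N → ℝ) (k : Fin N) => ((h k : ℝ) : UnitAddCircle)) :=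
    IsOpenMap.piMap (f := fun (_ : Fin N) (t : ℝ) => (t : UnitAddCircle))
      (fun _ => QuotientAddGroup.isOpenMap_coe) (by simp)
  exact h1.comp (EuclideanSpace.equiv (Fin N) ℝ).toHomeomorph.isOpenMap

theorem proj_surjective : Function.Surjective (proj : Euc N → Torus N) := by
  intro x
  choose a ha using fun k => QuotientAddGroup.mk_surjective (x k)
  exact ⟨WithLp.toLp 2 a, funext fun k => ha k⟩

/-- Every two points of the torus differ by the projection of a vector of bounded length. -/
theorem exists_proj_add_eq (x z : Torus N) : ∃ h : Euc N, ‖h‖ ≤ √N ∧ x + proj h = z := by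
  have h1 : ∀ k, ∃ t : ℝ, (t : UnitAddCircle) = z k - x k ∧ |t| ≤ 1 := by
    intro k
    refine ⟨(AddCircle.equivIoc 1 0 (z k - x k)).1, AddCircle.coe_equivIoc, ?_⟩
    have := (AddCircle.equivIoc 1 0 (z k - x k)).2
    rw [abs_le]; constructor <;> linarith [this.1, this.2]
  choose t ht ht1 using h1
  refine ⟨WithLp.toLp 2 t, ?_, ?_⟩
  · rw [EuclideanSpace.norm_eq]
    refine Real.sqrt_le_sqrt ?_
    calc ∑ i, ‖t i‖ ^ 2 ≤ ∑ _i : Fin N, (1 : ℝ) :=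
          Finset.sum_le_sum fun i _ => by
            rw [Real.norm_eq_abs]; exact pow_le_one₀ (abs_nonneg _) (ht1 i)
      _ = N := by simp
  · funext k
    have := ht k
    simp [proj, this]

theorem abs_apply_le_norm (h : Euc N) (k : Fin N) : |h k| ≤ ‖h‖ := by
  simpa using PiLp.norm_apply_le h k

theorem proj_injOn {h k : Euc N} (hk : ‖h - k‖ < 1) (e : proj h = proj k) : h = k := by
  ext i
  have h1 : ((h i : ℝ) : UnitAddCircle) = (k i : ℝ) := congrFun e i
  have h2 : ((h i - k i : ℝ) : UnitAddCircle) = 0 := by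
    rw [AddCircle.coe_sub, h1, sub_self]
  obtain ⟨n, hn⟩ := AddCircle.coe_eq_zero_iff (1 : ℝ) |>.1 h2
  have h3 : |h i - k i| < 1 := lt_of_le_of_lt (by simpa using abs_apply_le_norm (h - k) i) hk
  have h4 : (n : ℝ) = h i - k i := by simpa using hn
  rw [← h4] at h3
  have h5 : |n| < 1 := by
    rw [← Int.cast_abs, ← Int.cast_one, Int.cast_lt] at h3
    exact h3
  have h6 : n = 0 := Int.abs_lt_one_iff.1 h5
  rw [h6] at h4
  push_cast at h4
  linarith

theorem continuous_add_proj (x : Torus N) : Continuous fun h : Euc N => x + proj h :=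
  continuous_const.add continuous_proj

theorem nhds_add_proj (x : Torus N) (h : Euc N) :
    map (fun h => x + proj h) (𝓝 h) = 𝓝 (x + proj h) :=
  ((Homeomorph.addLeft x).isOpenMap.comp isOpenMap_proj).map_nhds_eq
    (continuous_add_proj x).continuousAt

theorem inChart_zero (u : Torus N → ℝ) (x : Torus N) : inChart u x 0 = u x := by
  simp [inChart, proj_zero]

theorem inChart_translate (u : Torus N → ℝ) (x : Torus N) (h k : Euc N) :
    inChart u (x + proj h) k = inChart u x (h + k) := by
  simp [inChart, proj_add, add_assoc]

theorem continuous_inChart {u : Torus N → ℝ} (hu : Continuous u) (x : Torus N) :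
    Continuous (inChart u x) := hu.comp (continuous_add_proj x)

theorem continuousAt_of_inChart {u : Torus N → ℝ} {x : Torus N} {h : Euc N}
    (hu : ContinuousAt (inChart u x) h) : ContinuousAt u (x + proj h) := by
  unfold ContinuousAt
  rw [← nhds_add_proj, tendsto_map'_iff]
  exact hu

/-! ### Gradients -/

theorem hasGradientAt_translate {f : Euc N → ℝ} {p h : Euc N} :
    HasGradientAt (fun k => f (h + k)) p 0 ↔ HasGradientAt f p h := by
  simp only [hasGradientAt_iff_hasFDerivAt]
  have := hasFDerivAt_comp_add_left (𝕜 := ℝ) (f := f) (f' := InnerProductSpace.toDual ℝ (Euc N) p)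
    (a := h) (x := (0 : Euc N))
  simpa using this

theorem hasGradientAt_add {f g : Euc N → ℝ} {p q h : Euc N} (hf : HasGradientAt f p h)
    (hg : HasGradientAt g q h) : HasGradientAt (fun k => f k + g k) (p + q) h := by
  rw [hasGradientAt_iff_hasFDerivAt] at *
  rw [map_add]; exact hf.add hg

theorem hasGradientAt_sub {f g : Euc N → ℝ} {p q h : Euc N} (hf : HasGradientAt f p h)
    (hg : HasGradientAt g q h) : HasGradientAt (fun k => f k - g k) (p - q) h := by
  rw [hasGradientAt_iff_hasFDerivAt] at *
  rw [map_sub]; exact hf.sub hg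

theorem hasGradientAt_const_mul {f : Euc N → ℝ} {p h : Euc N} (hf : HasGradientAt f p h) (c : ℝ) :
    HasGradientAt (fun k => c * f k) (c • p) h := by
  rw [hasGradientAt_iff_hasFDerivAt] at *
  have := hf.const_mul c
  simpa using this

theorem hasGradientAt_inner (p h : Euc N) : HasGradientAt (fun k => inner ℝ p k) p h := by
  rw [hasGradientAt_iff_hasFDerivAt]
  exact (InnerProductSpace.toDual ℝ (Euc N) p).hasFDerivAt

theorem hasGradientAt_norm_sq (h : Euc N) : HasGradientAt (fun k => ‖k‖ ^ 2) ((2 : ℝ) • h) h := by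
  rw [hasGradientAt_iff_hasFDerivAt]
  have h1 := (hasStrictFDerivAt_norm_sq h).hasFDerivAt
  have h2 : InnerProductSpace.toDual ℝ (Euc N) ((2 : ℝ) • h) = 2 • (innerSL ℝ) h := by
    ext k; simp [two_mul]
  rw [h2]; exact h1

theorem contDiffAt_hasGradientAt {f : Euc N → ℝ} {h : Euc N} (hf : ContDiffAt ℝ 1 f h) :
    HasGradientAt f (gradient f h) h :=
  (hf.differentiableAt (by norm_num)).hasGradientAt

theorem continuousAt_gradient {f : Euc N → ℝ} {h : Euc N} (hf : ContDiffAt ℝ 1 f h) :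
    ContinuousAt (gradient f) h := by
  have : ContinuousAt (fderiv ℝ f) h := (hf.fderiv_right (m := 0) (by norm_num)).continuousAt
  exact (InnerProductSpace.toDual ℝ (Euc N)).symm.continuous.continuousAt.comp this

theorem eventually_contDiffAt {f : Euc N → ℝ} {h : Euc N} (hf : ContDiffAt ℝ 1 f h) :
    ∀ᶠ k in 𝓝 h, ContDiffAt ℝ 1 f k := hf.eventually (by simp)

theorem isLocalMax_translate {f : Euc N → ℝ} {h : Euc N} (hf : IsLocalMax f h) :
    IsLocalMax (fun k => f (h + k)) 0 := by
  have : Tendsto (fun k : Euc N => h + k) (𝓝 0) (𝓝 h) := by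
    have : ContinuousAt (fun k : Euc N => h + k) 0 := by fun_prop
    simpa [ContinuousAt] using this
  simpa [IsLocalMax, IsMaxFilter] using this.eventually hf

theorem isLocalMin_translate {f : Euc N → ℝ} {h : Euc N} (hf : IsLocalMin f h) :
    IsLocalMin (fun k => f (h + k)) 0 := by
  have : Tendsto (fun k : Euc N => h + k) (𝓝 0) (𝓝 h) := by
    have : ContinuousAt (fun k : Euc N => h + k) 0 := by fun_prop
    simpa [ContinuousAt] using this
  simpa [IsLocalMin, IsMinFilter] using this.eventually hf

theorem contDiffAt_translate {f : Euc N → ℝ} {h : Euc N} (hf : ContDiffAt ℝ 1 f h) :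
    ContDiffAt ℝ 1 (fun k => f (h + k)) 0 := by
  refine ContDiffAt.comp (0 : Euc N) (g := f) (by simpa using hf) (by fun_prop)

theorem mem_superdiff_of_isLocalMax {u : Torus N → ℝ} {x : Torus N} {φ : Euc N → ℝ} {h p : Euc N}
    (hφ : ContDiffAt ℝ 1 φ h) (hmax : IsLocalMax (fun k => inChart u x k - φ k) h)
    (hp : HasGradientAt φ p h) : p ∈ superdiff u (x + proj h) := by
  refine ⟨fun k => φ (h + k), contDiffAt_translate hφ, ?_, hasGradientAt_translate.2 hp⟩
  simp only [inChart_translate]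
  exact isLocalMax_translate (f := fun k => inChart u x k - φ k) hmax

theorem mem_subdiff_of_isLocalMin {u : Torus N → ℝ} {x : Torus N} {φ : Euc N → ℝ} {h p : Euc N}
    (hφ : ContDiffAt ℝ 1 φ h) (hmin : IsLocalMin (fun k => inChart u x k - φ k) h)
    (hp : HasGradientAt φ p h) : p ∈ subdiff u (x + proj h) := by
  refine ⟨fun k => φ (h + k), contDiffAt_translate hφ, ?_, hasGradientAt_translate.2 hp⟩
  simp only [inChart_translate]
  exact isLocalMin_translate (f := fun k => inChart u x k - φ k) hmin

theorem hasGrad_add_proj {u : Torus N → ℝ} {x : Torus N} {h p : Euc N} :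
    HasGrad u (x + proj h) p ↔ HasGradientAt (inChart u x) p h := by
  rw [HasGrad, ← hasGradientAt_translate (h := h)]
  have : inChart u (x + proj h) = fun k => inChart u x (h + k) :=
    funext fun k => inChart_translate u x h k
  rw [this]

/-- A function on a ball whose value at the centre exceeds its values on the sphere has an
interior maximum. -/
theorem exists_isLocalMax_mem_ball {f : Euc N → ℝ} {r : ℝ} (hr : 0 < r)
    (hf : ContinuousOn f (Metric.closedBall 0 r)) (hs : ∀ h, ‖h‖ = r → f h < f 0) :
    ∃ h, ‖h‖ < r ∧ IsLocalMax f h ∧ ∀ k, ‖k‖ ≤ r → f k ≤ f h := by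
  obtain ⟨h, hh, hmax⟩ := (isCompact_closedBall (0 : Euc N) r).exists_isMaxOn
    ⟨0, by simp [hr.le]⟩ hf
  have h0 : f 0 ≤ f h := hmax (by simp [hr.le])
  have hlt : ‖h‖ < r := by
    refine lt_of_le_of_ne (by simpa using hh) fun e => ?_
    exact absurd h0 (not_le.2 (hs h e))
  refine ⟨h, hlt, ?_, fun k hk => hmax (by simpa using hk)⟩
  refine hmax.isLocalMax (mem_of_superset (Metric.isOpen_ball.mem_nhds ?_) Metric.ball_subset_closedBall)
  simpa using hlt

/-! ### Measure on the torus -/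

/-- The half-open unit cube centred at `a`. -/
def cube (a : Euc N) : Set (Euc N) := {h | ∀ k, h k ∈ Set.Ioc (a k - 1 / 2) (a k - 1 / 2 + 1)}

theorem measurePreserving_proj (a : Euc N) :
    MeasurePreserving (proj : Euc N → Torus N) (volume.restrict (cube a)) volume := by
  have h1 := measurePreserving_pi (fun k => volume.restrict (Set.Ioc (a k - 1/2) (a k - 1/2 + 1)))
    (fun _ : Fin N => (volume : Measure UnitAddCircle))
    (fun k => AddCircle.measurePreserving_mk 1 (a k - 1 / 2))
  rw [← Measure.restrict_pi_pi] at h1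
  have h2 := (PiLp.volume_preserving_ofLp (Fin N)).restrict_preimage
    (s := Set.univ.pi fun k => Set.Ioc (a k - 1/2) (a k - 1/2 + 1))
    (MeasurableSet.univ_pi fun k => measurableSet_Ioc)
  have h3 := h1.comp h2
  have h4 : cube a = WithLp.ofLp ⁻¹'
      (Set.univ.pi fun k => Set.Ioc (a k - 1/2) (a k - 1/2 + 1)) := by
    ext h; simp [cube]
  rw [h4]
  exact h3

/-- Representative of a point of the torus in the unit cube. -/
noncomputable def rep (x : Torus N) : Euc N :=
  WithLp.toLp 2 fun k => (AddCircle.equivIoc 1 (-1 / 2 : ℝ) (x k)).1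

theorem proj_rep (x : Torus N) : proj (rep x) = x :=
  funext fun _ => AddCircle.coe_equivIoc

theorem measurable_rep : Measurable (rep : Torus N → Euc N) := by
  refine (WithLp.measurable_toLp 2 _).comp ?_
  refine measurable_pi_lambda _ fun k => ?_
  exact measurable_subtype_coe.comp
    ((AddCircle.measurableEquivIoc 1 (-1 / 2 : ℝ)).measurable.comp (measurable_pi_apply k))

theorem rep_proj {h : Euc N} (hh : h ∈ cube (0 : Euc N)) : rep (proj h) = h := by
  ext k
  have := hh k
  have h2 : h k ∈ Set.Ioc (-1 / 2 : ℝ) (-1 / 2 + 1) := by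
    simp at this ⊢; constructor <;> linarith [this.1, this.2]
  simp [rep, proj, AddCircle.equivIoc_coe_eq h2]

theorem measurableSet_cube (a : Euc N) : MeasurableSet (cube a) := by
  have : cube a = ⋂ k, (fun h : Euc N => h k) ⁻¹' Set.Ioc (a k - 1 / 2) (a k - 1 / 2 + 1) := by
    ext; simp [cube]
  rw [this]
  refine MeasurableSet.iInter fun k => measurableSet_Ioc.preimage ?_
  exact (by fun_prop : Continuous fun h : Euc N => h k).measurable

/-- A property valid at almost every point of the Euclidean space is valid at the representative of
almost every point of the torus. -/
theorem ae_rep {P : Euc N → Prop} (hP : ∀ᵐ h, P h) : ∀ᵐ x : Torus N, P (rep x) := by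
  have hq := (measurePreserving_proj (0 : Euc N))
  have : Measure.map rep (volume : Measure (Torus N)) = volume.restrict (cube (0 : Euc N)) := by
    rw [← hq.map_eq, Measure.map_map measurable_rep hq.measurable]
    have : (rep ∘ proj : Euc N → Euc N) =ᵐ[volume.restrict (cube 0)] id :=
      (ae_restrict_iff' (measurableSet_cube 0)).2 (Eventually.of_forall fun h hh => rep_proj hh)
    rw [Measure.map_congr this, Measure.map_id]
  refine ae_of_ae_map measurable_rep.aemeasurable ?_
  rw [this]
  exact ae_restrict_of_ae hP

/-- A property valid at almost every point of the torus is valid at almost every point of the ball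
of radius `1/2` of each chart. -/
theorem ae_chart {P : Torus N → Prop} (hP : ∀ᵐ x, P x) (x : Torus N) :
    ∀ᵐ h : Euc N, ‖h‖ < 1 / 2 → P (x + proj h) := by
  obtain ⟨a, rfl⟩ := proj_surjective x
  have h1 := (measurePreserving_proj a).quasiMeasurePreserving.ae hP
  rw [ae_restrict_iff' (measurableSet_cube a)] at h1
  have h2 : ∀ᵐ h : Euc N, a + h ∈ cube a → P (proj (a + h)) :=
    (measurePreserving_add_left volume a).quasiMeasurePreserving.ae h1
  filter_upwards [h2] with h hh hn
  rw [← proj_add]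
  refine hh fun k => ?_
  have := (abs_lt.1 ((abs_apply_le_norm h k).trans_lt hn))
  simp; constructor <;> linarith [this.1, this.2]

/-- Rademacher's theorem on the torus. -/
theorem ae_exists_hasGrad {u : Torus N → ℝ} {K : NNReal} (hu : LipschitzWith K (inChart u 0)) :
    ∀ᵐ x : Torus N, ∃ p, HasGrad u x p := by
  have h1 : ∀ᵐ h : Euc N, DifferentiableAt ℝ (inChart u 0) h := hu.ae_differentiableAt
  filter_upwards [ae_rep h1] with x hx
  have := hasGrad_add_proj (x := (0 : Torus N)).2 hx.hasGradientAt
  rw [proj_rep, zero_add] at this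
  exact ⟨_, this⟩

/-! ### Superdifferentials: density, approximation and Lipschitz bounds. -/

theorem continuous_couple {B : Torus N → Matrix (Fin m) (Fin m) ℝ} (hB : Continuous B)
    {u : Fin m → Torus N → ℝ} (hu : ∀ i, Continuous (u i)) (i : Fin m) :
    Continuous fun x => couple B u x i := by
  unfold couple
  exact continuous_finsetSum _ fun j _ => (hB.matrix_elem i j).mul (hu j)

theorem exists_abs_le {f : Torus N → ℝ} (hf : Continuous f) : ∃ C, ∀ x, |f x| ≤ C := by
  obtain ⟨C, hC⟩ := isCompact_univ.exists_bound_of_continuousOn hf.continuousOn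
  exact ⟨C, fun x => by simpa using hC x (Set.mem_univ x)⟩

/-- An inequality valid up to arbitrarily small errors at nearby points is valid. -/
theorem le_of_approx {F : Torus N → Euc N → ℝ} (hF : Continuous fun z : Torus N × Euc N => F z.1 z.2)
    {x : Torus N} {p : Euc N} {c : ℝ}
    (happ : ∀ ε > 0, ∃ h q : Euc N, ‖h‖ < ε ∧ ‖q - p‖ < ε ∧ F (x + proj h) q ≤ c + ε) :
    F x p ≤ c := by
  by_contra! hc
  have hG : Continuous fun z : Euc N × Euc N => F (x + proj z.1) z.2 :=
    hF.comp (((continuous_add_proj x).comp continuous_fst).prodMk continuous_snd)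
  have h0 : c + (F x p - c) / 2 < F (x + proj ((0, p) : Euc N × Euc N).1) p := by
    simp only [proj_zero, add_zero]; linarith
  obtain ⟨ε, hε, hball⟩ := Metric.mem_nhds_iff.1 (hG.continuousAt.eventually (lt_mem_nhds h0))
  obtain ⟨h, q, hh, hq, hle⟩ := happ (min ε ((F x p - c) / 2)) (lt_min hε (by linarith))
  have : (h, q) ∈ Metric.ball ((0, p) : Euc N × Euc N) ε := by
    rw [Metric.mem_ball, Prod.dist_eq, max_lt_iff]
    exact ⟨by simpa using hh.trans_le (min_le_left _ _),
      by simpa [dist_eq_norm] using hq.trans_le (min_le_left _ _)⟩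
  have h1 := hball this
  simp only [Set.mem_ofPred_eq] at h1
  linarith [min_le_right ε ((F x p - c) / 2)]

theorem contDiff_const_mul_norm_sq (K : ℝ) : ContDiff ℝ 1 fun k : Euc N => K * ‖k‖ ^ 2 :=
  contDiff_const.mul (contDiff_norm_sq ℝ)

theorem exists_superdiff_nonempty {u : Torus N → ℝ} (hu : Continuous u) (x : Torus N) {ε : ℝ}
    (hε : 0 < ε) : ∃ h : Euc N, ‖h‖ < ε ∧ (superdiff u (x + proj h)).Nonempty := by
  obtain ⟨C, hC⟩ := exists_abs_le hu
  have hC0 : 0 ≤ C := (abs_nonneg _).trans (hC x)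
  -- On the sphere of radius `ε` the penalty is `2C + 1`, more than the oscillation of `u`, so the
  -- maximum is interior.
  set K := (2 * C + 1) / ε ^ 2
  obtain ⟨h, hh, hmax, -⟩ := exists_isLocalMax_mem_ball (f := fun k => inChart u x k - K * ‖k‖ ^ 2) hε
    ((continuous_inChart hu x).sub (contDiff_const_mul_norm_sq K).continuous).continuousOn (by
      intro k hk
      have h1 : K * ‖k‖ ^ 2 = 2 * C + 1 := by
        rw [hk]; exact div_mul_cancel₀ _ (by positivity)
      have h2 := (abs_le.1 (hC x)).1
      have h3 := (abs_le.1 (hC (x + proj k))).2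
      simp only [h1, inChart_zero, norm_zero]
      simp only [inChart]
      linarith)
  exact ⟨h, hh, _, mem_superdiff_of_isLocalMax (contDiff_const_mul_norm_sq K).contDiffAt hmax
    (hasGradientAt_const_mul (hasGradientAt_norm_sq h) K)⟩

/-- The gradient at a point of differentiability is a limit of superdifferentials at nearby
points. -/
theorem exists_superdiff_near {u : Torus N → ℝ} (hu : Continuous u) {x : Torus N} {p : Euc N}
    (hp : HasGrad u x p) {ε : ℝ} (hε : 0 < ε) :
    ∃ h q : Euc N, ‖h‖ < ε ∧ ‖q - p‖ < ε ∧ q ∈ superdiff u (x + proj h) := by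
  have h1 := (hasGradientAt_iff_isLittleO.1 hp).def (c := ε / 8) (by linarith)
  obtain ⟨r, hr, hball⟩ := Metric.eventually_nhds_iff.1 h1
  set s := min r ε / 2
  have hs : 0 < s := by positivity
  have hsr : s < r := by have := min_le_left r ε; simp only [s]; linarith
  have hse : s < ε := by have := min_le_right r ε; simp only [s]; linarith
  -- On the sphere of radius `s` the penalty `εs/4` beats the linearisation error `εs/8`. At the
  -- maximum, comparison with the centre gives `K‖h‖ ≤ ε/8`, so the gradient moves by at most `ε/4`.
  set K := ε / 4 / s
  have hK : 0 < K := by positivity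
  have key : ∀ k : Euc N, ‖k‖ ≤ s → |inChart u x k - inChart u x 0 - inner ℝ p k| ≤ ε / 8 * ‖k‖ := by
    intro k hk
    have := hball (y := k) (by simpa using lt_of_le_of_lt hk hsr)
    simpa using this
  have hcd : ContDiff ℝ 1 fun k : Euc N => inner ℝ p k + K * ‖k‖ ^ 2 :=
    (contDiff_const.inner ℝ contDiff_id).add (contDiff_const_mul_norm_sq K)
  obtain ⟨h, hh, hmax, hge⟩ := exists_isLocalMax_mem_ball
    (f := fun k => inChart u x k - (inner ℝ p k + K * ‖k‖ ^ 2)) hs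
    ((continuous_inChart hu x).sub hcd.continuous).continuousOn (by
      intro k hk
      have h2 := (abs_le.1 (key k hk.le)).2
      have h3 : K * ‖k‖ ^ 2 = ε / 4 * s := by
        rw [hk]; simp only [K]; field_simp
      rw [hk] at h2
      have : 0 < ε * s := by positivity
      simp only [h3, norm_zero, inner_zero_right]
      linarith)
  refine ⟨h, p + K • (2 : ℝ) • h, hh.trans hse, ?_, mem_superdiff_of_isLocalMax hcd.contDiffAt hmax
    (hasGradientAt_add (hasGradientAt_inner p h)
      (hasGradientAt_const_mul (hasGradientAt_norm_sq h) K))⟩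
  have h2 := (abs_le.1 (key h hh.le)).2
  have h3 := hge 0 (by simpa using hs.le)
  simp only [norm_zero, inner_zero_right] at h3
  have h4 : K * ‖h‖ * ‖h‖ ≤ ε / 8 * ‖h‖ := by nlinarith
  have h5 : K * ‖h‖ ≤ ε / 8 := by
    rcases (norm_nonneg h).eq_or_lt with h0 | h0
    · rw [← h0]; simp; linarith
    · exact le_of_mul_le_mul_right h4 h0
  rw [add_sub_cancel_left, norm_smul, norm_smul, Real.norm_of_nonneg hK.le]
  simp only [Real.norm_ofNat]
  linarith

/-- A continuous function with superdifferentials bounded by `R` is `R`-Lipschitz. -/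
theorem le_add_of_superdiff_bound {u : Torus N → ℝ} (hu : Continuous u) {R : ℝ} (hR : 0 ≤ R)
    (hbd : ∀ x, ∀ p ∈ superdiff u x, ‖p‖ ≤ R) (x : Torus N) (h : Euc N) :
    u (x + proj h) ≤ u x + R * ‖h‖ := by
  obtain ⟨C, hC⟩ := exists_abs_le hu
  have hC0 : 0 ≤ C := (abs_nonneg _).trans (hC x)
  refine le_of_forall_pos_le_add fun ε hε => ?_
  -- A cone of slope `L > R` touches `u` from above away from its vertex if the estimate fails by
  -- `ε`; its gradient there has norm at least `L`, contradicting the bound `R`.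
  set L := R + ε / (‖h‖ + 1)
  have hL : R < L := by simp only [L]; linarith [show 0 < ε / (‖h‖ + 1) by positivity]
  have hLh : L * ‖h‖ ≤ R * ‖h‖ + ε := by
    have : ε / (‖h‖ + 1) * ‖h‖ ≤ ε := by
      rw [div_mul_eq_mul_div, div_le_iff₀ (by positivity)]; nlinarith [norm_nonneg h]
    simp only [L]; linarith
  by_contra! hlt
  set r := ‖h‖ + (2 * C + 1) / L
  have hL0 : 0 < L := hR.trans_lt hL
  have hcont : Continuous fun k => inChart u x k - L * ‖k‖ :=
    (continuous_inChart hu x).sub (continuous_const.mul continuous_norm)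
  obtain ⟨k, hk, hmax, hge⟩ := exists_isLocalMax_mem_ball (r := r)
    (f := fun k => inChart u x k - L * ‖k‖) (by positivity) hcont.continuousOn (by
      intro k hk
      have h1 : 2 * C + 1 ≤ L * ‖k‖ := by
        rw [hk, mul_add, mul_div_cancel₀ _ hL0.ne']
        have := mul_nonneg hL0.le (norm_nonneg h)
        linarith
      have h2 := (abs_le.1 (hC x)).1
      have h3 := (abs_le.1 (hC (x + proj k))).2
      simp only [inChart_zero, norm_zero]
      simp only [inChart]
      linarith)
  have hk0 : k ≠ 0 := by
    rintro rfl
    have := hge h (by simp only [r]; linarith [show 0 < (2 * C + 1) / L by positivity])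
    simp only [inChart_zero, norm_zero] at this
    simp only [inChart] at this
    linarith
  have hcd : ContDiffAt ℝ 1 (fun k : Euc N => ‖k‖) k := contDiffAt_norm ℝ hk0
  have hg := contDiffAt_hasGradientAt hcd
  have hmem := mem_superdiff_of_isLocalMax (contDiffAt_const.mul hcd) hmax
    (hasGradientAt_const_mul hg L)
  have h1 := hbd _ _ hmem
  have h2 : inner ℝ (gradient (fun k : Euc N => ‖k‖) k) k = ‖k‖ := by
    rw [← hg.fderiv_apply]
    exact (hcd.differentiableAt (by norm_num)).fderiv_norm_self
  have h3 : 1 ≤ ‖gradient (fun k : Euc N => ‖k‖) k‖ := by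
    have h4 := real_inner_le_norm (gradient (fun k : Euc N => ‖k‖) k) k
    rw [h2] at h4
    have h5 : 0 < ‖k‖ := norm_pos_iff.2 hk0
    nlinarith
  rw [norm_smul, Real.norm_of_nonneg hL0.le] at h1
  nlinarith

/-! ### A priori estimates -/

theorem sum_degenerate_mul {B : Matrix (Fin m) (Fin m) ℝ} (hB : IsDegenerate B) (v : Fin m → ℝ)
    (c : ℝ) (i : Fin m) : ∑ j, B i j * (v j - c) = ∑ j, B i j * v j := by
  simp only [mul_sub, Finset.sum_sub_distrib, ← Finset.sum_mul]
  rw [hB i]; ring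

/-- Irreducibility links some index `i` of the argmax set of `v` to an index outside it. After
subtracting the maximum, which zero row sums allow, every term of row `i` is nonnegative and the
linked one is positive. -/
theorem exists_pos_of_irred {B : Matrix (Fin m) (Fin m) ℝ} (hc : IsCoupling B) (hi : IsIrred B)
    (hd : IsDegenerate B) {v : Fin m → ℝ} {i₁ i₂ : Fin m} (hmax : ∀ j, v j ≤ v i₁)
    (hlt : v i₂ < v i₁) : ∃ i, 0 < ∑ j, B i j * v j := by
  obtain ⟨i, hiI, j, hjI, hij⟩ := hi {i | v i = v i₁} ⟨i₁, rfl⟩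
    (fun h => hlt.ne (h.symm ▸ Set.mem_univ i₂ : i₂ ∈ {i | v i = v i₁}))
  refine ⟨i, ?_⟩
  simp only [Set.mem_ofPred_eq] at hiI hjI
  rw [← sum_degenerate_mul hd v (v i₁)]
  have hji : j ≠ i := by rintro rfl; exact hjI hiI
  have hnn : ∀ k, 0 ≤ B i k * (v k - v i₁) := by
    intro k
    by_cases hk : k = i
    · rw [hk, hiI]; simp
    · exact mul_nonneg_of_nonpos_of_nonpos (hc.1 i k hk) (by linarith [hmax k])
  refine Finset.sum_pos' (fun k _ => hnn k) ⟨j, Finset.mem_univ j, ?_⟩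
  exact mul_pos_of_neg_of_neg (lt_of_le_of_ne (hc.1 i j hji) hij)
    (by linarith [lt_of_le_of_ne (hmax j) hjI])

/-- Vectors normalised to have minimum `0` and maximum `1` form, together with `x`, a compact set on
which the sum of the positive parts of the rows of `B v` is positive, hence at least some `c > 0`. A
vector of spread `s`, once normalised, makes this sum at most `mC/s`, so `s ≤ mC/c`. -/
theorem exists_spread_bound {B : Torus N → Matrix (Fin m) (Fin m) ℝ} (hBcont : Continuous B)
    (hBcoup : ∀ x, IsCoupling (B x)) (hBirr : ∀ x, IsIrred (B x)) (hBdeg : ∀ x, IsDegenerate (B x))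
    {C : ℝ} (hC : 0 ≤ C) :
    ∃ D, 0 ≤ D ∧ ∀ x (v : Fin m → ℝ), (∀ i, ∑ j, B x i j * v j ≤ C) → ∀ i j, v i - v j ≤ D := by
  set K : Set (Torus N × (Fin m → ℝ)) :=
    (Set.univ ×ˢ Set.univ.pi fun _ => Set.Icc 0 1) ∩
      ((⋃ i, {z | z.2 i = 0}) ∩ ⋃ i, {z | z.2 i = 1})
  have hK : IsCompact K := by
    refine (isCompact_univ.prod (isCompact_univ_pi fun _ => isCompact_Icc)).inter_right ?_
    refine (isClosed_iUnion_of_finite fun i => ?_).inter (isClosed_iUnion_of_finite fun i => ?_) <;>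
    exact isClosed_eq (by fun_prop) continuous_const
  set G : Torus N × (Fin m → ℝ) → ℝ := fun z => ∑ i, max (∑ j, B z.1 i j * z.2 j) 0
  have hG : Continuous G := by
    refine continuous_finsetSum _ fun i _ => Continuous.max ?_ continuous_const
    exact continuous_finsetSum _ fun j _ =>
      ((hBcont.matrix_elem i j).comp continuous_fst).mul (by fun_prop)
  have hpos : ∀ z ∈ K, 0 < G z := by
    rintro ⟨x, v⟩ ⟨⟨-, hv⟩, h0, h1⟩
    simp only [Set.mem_iUnion, Set.mem_ofPred_eq] at h0 h1
    obtain ⟨i₂, h0⟩ := h0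
    obtain ⟨i₁, h1⟩ := h1
    obtain ⟨i, hi⟩ := exists_pos_of_irred (hBcoup x) (hBirr x) (hBdeg x) (v := v) (i₁ := i₁)
      (i₂ := i₂) (fun j => by rw [h1]; exact (hv j (Set.mem_univ j)).2) (by rw [h0, h1]; norm_num)
    exact Finset.sum_pos' (fun k _ => le_max_right _ _) ⟨i, Finset.mem_univ i, lt_max_of_lt_left hi⟩
  obtain ⟨c, hc, hcK⟩ := hK.exists_forall_le' hG.continuousOn hpos
  refine ⟨m * C / c, by positivity, fun x v hv i j => ?_⟩
  obtain ⟨i₁, -, hi₁⟩ := Finset.exists_max_image Finset.univ v ⟨i, Finset.mem_univ i⟩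
  obtain ⟨i₂, -, hi₂⟩ := Finset.exists_min_image Finset.univ v ⟨i, Finset.mem_univ i⟩
  have hle : v i - v j ≤ v i₁ - v i₂ := by
    linarith [hi₁ i (Finset.mem_univ i), hi₂ j (Finset.mem_univ j)]
  refine hle.trans ?_
  set s := v i₁ - v i₂
  rcases le_or_gt s 0 with hs | hs
  · exact hs.trans (by positivity)
  have hmem : ((x, fun k => (v k - v i₂) / s) : Torus N × (Fin m → ℝ)) ∈ K := by
    refine ⟨⟨Set.mem_univ _, fun k _ => ⟨?_, ?_⟩⟩, Set.mem_iUnion.2 ⟨i₂, ?_⟩,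
      Set.mem_iUnion.2 ⟨i₁, ?_⟩⟩
    · exact div_nonneg (by linarith [hi₂ k (Finset.mem_univ k)]) hs.le
    · rw [div_le_one hs]; simp only [s]; linarith [hi₁ k (Finset.mem_univ k)]
    · simp
    · simp only [Set.mem_ofPred_eq]; exact div_self hs.ne'
  have h1 := hcK _ hmem
  have h2 : G (x, fun k => (v k - v i₂) / s) ≤ m * (C / s) := by
    have : ∀ i : Fin m, max (∑ j, B x i j * ((v j - v i₂) / s)) 0 ≤ C / s := by
      intro i
      refine max_le ?_ (by positivity)
      have : ∑ j, B x i j * ((v j - v i₂) / s) = (∑ j, B x i j * v j) / s := by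
        rw [← sum_degenerate_mul (hBdeg x) v (v i₂), Finset.sum_div]
        exact Finset.sum_congr rfl fun j _ => by ring
      rw [this]
      gcongr
      exact hv i
    refine (Finset.sum_le_sum fun i _ => this i).trans ?_
    simp
  rw [le_div_iff₀ hc]
  have h3 := h1.trans h2
  rw [← mul_div_assoc, le_div_iff₀ hs] at h3
  linarith

section System

variable {H : Fin m → Torus N → Euc N → ℝ} {B : Torus N → Matrix (Fin m) (Fin m) ℝ}

theorem exists_lower_bound (hH : ∀ i, IsConvexHamiltonian (H i)) :
    ∃ C, 0 ≤ C ∧ ∀ i x p, -C ≤ H i x p := by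
  have h1 : ∀ i, ∃ C, ∀ x p, -C ≤ H i x p := by
    intro i
    obtain ⟨α, β, hα, -, hab⟩ := (hH i).coercive
    obtain ⟨R, hR⟩ := eventually_atTop.1 (hα.eventually (eventually_ge_atTop 0))
    obtain ⟨C, hC⟩ := (isCompact_univ.prod (isCompact_closedBall (0 : Euc N) R)).exists_bound_of_continuousOn
      (hH i).continuous.continuousOn
    refine ⟨max C 0, fun x p => ?_⟩
    by_cases hp : ‖p‖ ≤ R
    · have := hC (x, p) ⟨Set.mem_univ _, by simpa using hp⟩
      have := (abs_le.1 this).1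
      linarith [le_max_left C 0]
    · have := (hR ‖p‖ (not_le.1 hp).le).trans (hab x p).1
      linarith [le_max_right C 0]
  choose C hC using h1
  refine ⟨∑ i, |C i|, by positivity, fun i x p => ?_⟩
  have := Finset.single_le_sum (f := fun i => |C i|) (fun i _ => abs_nonneg _) (Finset.mem_univ i)
  linarith [hC i x p, le_abs_self (C i)]

theorem exists_coercivity_radius (hH : ∀ i, IsConvexHamiltonian (H i)) (C : ℝ) :
    ∃ R, 0 ≤ R ∧ ∀ i x p, H i x p ≤ C → ‖p‖ ≤ R := by
  have h1 : ∀ i, ∃ R, ∀ x p, H i x p ≤ C → ‖p‖ ≤ R := by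
    intro i
    obtain ⟨α, β, hα, -, hab⟩ := (hH i).coercive
    obtain ⟨R, hR⟩ := eventually_atTop.1 (hα.eventually (eventually_gt_atTop C))
    refine ⟨R, fun x p hp => ?_⟩
    by_contra! hlt
    linarith [hR ‖p‖ hlt.le, (hab x p).1]
  choose R hR using h1
  refine ⟨∑ i, |R i|, by positivity, fun i x p hp => ?_⟩
  have := Finset.single_le_sum (f := fun i => |R i|) (fun i _ => abs_nonneg _) (Finset.mem_univ i)
  linarith [hR i x p hp, le_abs_self (R i)]

theorem couple_eq_sum_sub (hBdeg : ∀ x, IsDegenerate (B x)) (u : Fin m → Torus N → ℝ) (x : Torus N)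
    (c : ℝ) (i : Fin m) : couple B u x i = ∑ j, B x i j * (u j x - c) :=
  (sum_degenerate_mul (hBdeg x) (fun j => u j x) c i).symm

theorem exists_entry_bound (hBcont : Continuous B) : ∃ C, 0 ≤ C ∧ ∀ x i j, |B x i j| ≤ C := by
  have h1 : ∀ i j, ∃ C, ∀ x, |B x i j| ≤ C := fun i j => exists_abs_le (hBcont.matrix_elem i j)
  choose C hC using h1
  refine ⟨∑ i, ∑ j, |C i j|, by positivity, fun x i j => ?_⟩
  have h2 := Finset.single_le_sum (f := fun i => ∑ j, |C i j|) (fun i _ => by positivity)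
    (Finset.mem_univ i)
  have h3 := Finset.single_le_sum (f := fun j => |C i j|) (fun j _ => abs_nonneg _)
    (Finset.mem_univ j)
  linarith [hC i j x, le_abs_self (C i j)]

/-- Subsolutions have uniformly bounded superdifferentials, they are equi-Lipschitz, and the
differences of their components are uniformly bounded. -/
theorem exists_apriori_bound (hH : ∀ i, IsConvexHamiltonian (H i)) (hBcont : Continuous B)
    (hBcoup : ∀ x, IsCoupling (B x)) (hBirr : ∀ x, IsIrred (B x))
    (hBdeg : ∀ x, IsDegenerate (B x)) (a : ℝ) :
    ∃ R, 0 < R ∧ ∀ u ∈ subsolutions H B fun _ => a,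
      (∀ i j x, u i x - u j x ≤ R) ∧ (∀ i x, ∀ p ∈ superdiff (u i) x, ‖p‖ ≤ R) ∧
      ∀ i x h, u i (x + proj h) ≤ u i x + R * ‖h‖ := by
  obtain ⟨C, hC0, hC⟩ := exists_lower_bound hH
  obtain ⟨D, hD0, hD⟩ := exists_spread_bound hBcont hBcoup hBirr hBdeg (C := |a| + C) (by positivity)
  obtain ⟨E, hE0, hE⟩ := exists_entry_bound hBcont
  obtain ⟨R, hR0, hR⟩ := exists_coercivity_radius hH (a + m * (E * D))
  refine ⟨max R D + 1, by positivity, fun u hu => ?_⟩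
  -- Where a superdifferential exists, this follows from the lower bound on `H`; such points are
  -- dense and the coupling term is continuous.
  have h1 : ∀ x i, couple B u x i ≤ |a| + C := by
    intro x i
    refine le_of_approx (F := fun x _ => couple B u x i)
      ((continuous_couple hBcont hu.1 i).comp continuous_fst) (p := 0) fun ε hε => ?_
    obtain ⟨h, hh, p, hp⟩ := exists_superdiff_nonempty (hu.1 i) x hε
    refine ⟨h, 0, hh, by simpa using hε, ?_⟩
    linarith [hu.2 _ i p hp, hC i (x + proj h) p, le_abs_self a]
  have h2 : ∀ i j x, u i x - u j x ≤ D := fun i j x => hD x (fun i => u i x) (h1 x) i j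
  -- The spread bound controls the coupling from below, hence `H` from above on superdifferentials,
  -- and coercivity applies.
  have h3 : ∀ i x, -(m * (E * D)) ≤ couple B u x i := by
    intro i x
    rw [couple_eq_sum_sub hBdeg u x (u i x) i]
    have : ∀ j ∈ Finset.univ, -(E * D) ≤ B x i j * (u j x - u i x) := by
      intro j _
      have h4 : |u j x - u i x| ≤ D := abs_le.2 ⟨by linarith [h2 i j x], h2 j i x⟩
      have h5 : |B x i j * (u j x - u i x)| ≤ E * D := by
        rw [abs_mul]; exact mul_le_mul (hE x i j) h4 (abs_nonneg _) hE0
      exact (abs_le.1 h5).1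
    have := Finset.sum_le_sum this
    simpa using this
  have h4 : ∀ i x, ∀ p ∈ superdiff (u i) x, ‖p‖ ≤ max R D + 1 := by
    intro i x p hp
    have := hR i x p (by linarith [hu.2 x i p hp, h3 i x])
    linarith [le_max_left R D]
  refine ⟨fun i j x => ?_, h4, fun i x h => ?_⟩
  · linarith [h2 i j x, le_max_right R D]
  · exact le_add_of_superdiff_bound (hu.1 i) (by positivity) (h4 i) x h

end System

/-! ### Mollification, and almost everywhere versus viscosity inequalities. -/

theorem norm_gradient_le {g : Euc N → ℝ} {K : NNReal} (hg : LipschitzWith K g) (h : Euc N) :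
    ‖gradient g h‖ ≤ K := by
  rw [gradient, LinearIsometryEquiv.norm_map]
  exact norm_fderiv_le_of_lipschitz ℝ hg

/-- Lipschitz functions are uniform limits of `C¹` functions whose gradients are averages of nearby
gradients of the given function. -/
theorem exists_contDiff_approx {g : Euc N → ℝ} {K : NNReal} (hg : LipschitzWith K g) {r ε : ℝ}
    (hr : 0 < r) (hε : 0 < ε) :
    ∃ φ : Euc N → ℝ, ContDiff ℝ 1 φ ∧ (∀ h, |φ h - g h| ≤ ε) ∧
      ∀ (h : Euc N) (s : Set (Euc N)), Convex ℝ s → IsClosed s →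
        (∀ᵐ z : Euc N, ‖z - h‖ < r → gradient g z ∈ s) → gradient φ h ∈ s := by
  set ρ := min r (ε / (K + 1))
  have hρ : 0 < ρ := lt_min hr (by positivity)
  let ψ : ContDiffBump (0 : Euc N) := ⟨ρ / 2, ρ, by positivity, by linarith⟩
  set n : Euc N → ℝ := ψ.normed volume
  have hn : Continuous n := ψ.continuous_normed
  have hnm : Measurable fun t => ENNReal.ofReal (n t) := hn.measurable.ennreal_ofReal
  -- With the mollifier seen as a probability measure, the gradient of the convolution is a mean of
  -- gradients of `g`, so it stays in any closed convex set containing almost all of them.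
  set μ : Measure (Euc N) := volume.withDensity fun t => ENNReal.ofReal (n t)
  have hprob : IsProbabilityMeasure μ := by
    refine ⟨?_⟩
    rw [withDensity_apply _ MeasurableSet.univ, setLIntegral_univ,
      ← ofReal_integral_eq_lintegral_ofReal ψ.integrable_normed
        (Eventually.of_forall fun t => ψ.nonneg_normed t), ψ.integral_normed, ENNReal.ofReal_one]
  have hsupp : ∀ᵐ t ∂μ, ‖t‖ < ρ := by
    rw [ae_withDensity_iff hnm]
    refine Eventually.of_forall fun t ht => ?_
    have : t ∈ Function.support n := fun h0 => ht (by rw [h0]; simp)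
    rw [ψ.support_normed_eq] at this
    simpa using this
  set φ : Euc N → ℝ := convolution n g (ContinuousLinearMap.lsmul ℝ ℝ) volume
  have hφ : ∀ h, φ h = ∫ t, g (h - t) ∂μ := by
    intro h
    rw [integral_withDensity_eq_integral_toReal_smul hnm (Eventually.of_forall fun t => by simp)]
    refine integral_congr_ae (Eventually.of_forall fun t => ?_)
    simp [ENNReal.toReal_ofReal (ψ.nonneg_normed t), n]
  have hsub : ∀ (h : Euc N) {P : Euc N → Prop}, (∀ᵐ z, P z) → ∀ᵐ t ∂μ, P (h - t) := by
    intro h P hP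
    exact (withDensity_absolutelyContinuous _ _).ae_le
      ((quasiMeasurePreserving_sub_left volume h).ae hP)
  have hderiv : ∀ h, Integrable (fun t => fderiv ℝ g (h - t)) μ ∧
      HasFDerivAt φ (∫ t, fderiv ℝ g (h - t) ∂μ) h := by
    intro h
    have h1 := hasFDerivAt_integral_of_dominated_loc_of_lip (μ := μ) (F := fun x t => g (x - t))
      (F' := fun t => fderiv ℝ g (h - t)) (x₀ := h) (bound := fun _ => (K : ℝ)) (𝕜 := ℝ)
      (s := Set.univ) univ_mem
      (Eventually.of_forall fun x =>
        (hg.continuous.comp (continuous_const.sub continuous_id)).aestronglyMeasurable)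
      (by
        refine Integrable.of_bound (C := |g h| + K * ρ)
          (hg.continuous.comp (continuous_const.sub continuous_id)).aestronglyMeasurable ?_
        filter_upwards [hsupp] with t ht
        have h2 := hg.dist_le_mul (h - t) h
        rw [Real.dist_eq, dist_eq_norm, sub_sub_cancel_left, norm_neg] at h2
        have h3 : (K : ℝ) * ‖t‖ ≤ K * ρ := by gcongr
        have h4 := abs_sub_abs_le_abs_sub (g (h - t)) (g h)
        rw [Real.norm_eq_abs]
        linarith)
      ((measurable_fderiv ℝ g).comp (measurable_const.sub measurable_id)).aestronglyMeasurable
      (Eventually.of_forall fun t => by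
        have : LipschitzWith (K * 1) (g ∘ fun x : Euc N => x - t) :=
          hg.comp (LipschitzWith.of_dist_le_mul fun a b => by simp)
        rw [Real.nnabs_coe]
        rw [mul_one] at this
        exact this.lipschitzOnWith)
      (integrable_const _)
      (by
        filter_upwards [hsub h hg.ae_differentiableAt] with t ht
        have := ht.hasFDerivAt
        exact (hasFDerivAt_comp_sub t).2 this)
    refine ⟨h1.1, ?_⟩
    have h2 : φ = fun x => ∫ t, g (x - t) ∂μ := funext hφ
    rw [h2]
    exact h1.2
  refine ⟨φ, ?_, fun h => ?_, fun h s hs hsc hae => ?_⟩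
  · exact ψ.hasCompactSupport_normed.contDiff_convolution_left (n := 1) _ ψ.contDiff_normed
      hg.continuous.locallyIntegrable
  · have := ψ.dist_normed_convolution_le (μ := volume) (g := g) (x₀ := h) (ε := ε)
      hg.continuous.aestronglyMeasurable (by
        intro z hz
        have h1 := hg.dist_le_mul z h
        have h2 : dist z h < ε / (K + 1) := lt_of_lt_of_le hz (min_le_right _ _)
        rw [lt_div_iff₀ (by positivity)] at h2
        nlinarith [dist_nonneg (x := z) (y := h)])
    simpa [Real.dist_eq] using this
  · rw [gradient, (hderiv h).2.fderiv]
    set T := (InnerProductSpace.toDual ℝ (Euc N)).symm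
    have hconv : Convex ℝ (T ⁻¹' s) := by
      intro a ha b hb c d hc hd hcd
      have := hs ha hb hc hd hcd
      simpa using this
    refine hconv.integral_mem (hsc.preimage T.continuous) ?_ (hderiv h).1
    filter_upwards [hsub h hae, hsupp] with t ht htr
    exact ht (by
      rw [sub_sub_cancel_left, norm_neg]
      exact htr.trans_le (min_le_left _ _))

/-- Uniform continuity on a compact set, after lifting `x` to the ball of radius `√N`, which covers
the torus. -/
theorem exists_modulus {F : Torus N → Euc N → ℝ} (hF : Continuous fun z : Torus N × Euc N => F z.1 z.2)
    (R : ℝ) {η : ℝ} (hη : 0 < η) :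
    ∃ ρ > 0, ∀ (x : Torus N) (h p q : Euc N), ‖h‖ ≤ ρ → ‖p‖ ≤ R → ‖q - p‖ ≤ ρ →
      |F (x + proj h) q - F x p| ≤ η := by
  have hG : Continuous fun z : Euc N × Euc N => F (proj z.1) z.2 :=
    hF.comp ((continuous_proj.comp continuous_fst).prodMk continuous_snd)
  have hK := (isCompact_closedBall (0 : Euc N) (√N + 1)).prod (isCompact_closedBall (0 : Euc N) (R + 1))
  obtain ⟨ρ, hρ, hu⟩ := Metric.uniformContinuousOn_iff.1
    (hK.uniformContinuousOn_of_continuous hG.continuousOn) η hη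
  refine ⟨min (ρ / 2) 1, by positivity, fun x h p q hh hp hq => ?_⟩
  obtain ⟨a, ha, rfl⟩ := exists_proj_add_eq (0 : Torus N) x
  have hh2 := hh.trans (min_le_right _ _)
  have hq2 := hq.trans (min_le_right _ _)
  have hh1 := hh.trans (min_le_left _ _)
  have hq1 := hq.trans (min_le_left _ _)
  have h1 := hu (a + h, q) ⟨?_, ?_⟩ (a, p) ⟨?_, ?_⟩ ?_
  · rw [zero_add, ← proj_add]
    exact (by simpa [Real.dist_eq] using h1 : |F (proj (a + h)) q - F (proj a) p| < η).le
  · simp only [Metric.mem_closedBall, dist_zero_right]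
    exact (norm_add_le a h).trans (by linarith)
  · simp only [Metric.mem_closedBall, dist_zero_right]
    have := norm_add_le p (q - p)
    rw [add_sub_cancel] at this
    linarith
  · simp only [Metric.mem_closedBall, dist_zero_right]; linarith
  · simp only [Metric.mem_closedBall, dist_zero_right]; linarith
  · rw [Prod.dist_eq, max_lt_iff, dist_eq_norm, dist_eq_norm]
    simp only [add_sub_cancel_left]
    exact ⟨by linarith, by linarith⟩

theorem lipschitzWith_inChart {u : Torus N → ℝ} {R : ℝ} (hR : 0 ≤ R)
    (hu : ∀ x h, u (x + proj h) ≤ u x + R * ‖h‖) (x : Torus N) :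
    LipschitzWith R.toNNReal (inChart u x) := by
  refine LipschitzWith.of_le_add_mul _ fun h k => ?_
  have := hu (x + proj k) (h - k)
  rw [add_assoc, ← proj_add, add_sub_cancel, ← dist_eq_norm] at this
  rw [Real.coe_toNNReal _ hR]
  exact this

section System

variable {H : Fin m → Torus N → Euc N → ℝ} {B : Torus N → Matrix (Fin m) (Fin m) ℝ}

theorem continuous_hamiltonian_add_couple (hH : ∀ i, IsConvexHamiltonian (H i)) (hBcont : Continuous B)
    {u : Fin m → Torus N → ℝ} (hu : ∀ i, Continuous (u i)) (i : Fin m) :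
    Continuous fun z : Torus N × Euc N => H i z.1 z.2 + couple B u z.1 i :=
  (hH i).continuous.add ((continuous_couple hBcont hu i).comp continuous_fst)

/-- Near a point where a Lipschitz function is an almost everywhere strict subsolution, it is a
uniform limit of `C¹` strict subsolutions. -/
theorem exists_contDiff_strict (hH : ∀ i, IsConvexHamiltonian (H i)) (hBcont : Continuous B)
    {w : Fin m → Torus N → ℝ} (hw : ∀ i, Continuous (w i)) {i : Fin m} {R : ℝ} (hR : 0 ≤ R)
    (hLip : ∀ x h, w i (x + proj h) ≤ w i x + R * ‖h‖) {V : Set (Torus N)} (hV : IsOpen V) {δ : ℝ}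
    (hae : ∀ᵐ x ∂(volume : Measure (Torus N)), x ∈ V →
      ∃ p, HasGrad (w i) x p ∧ H i x p + couple B w x i < -δ)
    {x : Torus N} (hx : x ∈ V) {η : ℝ} (hη : 0 < η) :
    ∃ ρ > 0, ∀ ε > 0, ∃ φ : Euc N → ℝ, ContDiff ℝ 1 φ ∧ (∀ h, |φ h - inChart (w i) x h| ≤ ε) ∧
      ∀ h, ‖h‖ ≤ ρ → ‖gradient φ h‖ ≤ R ∧ ∀ h', ‖h'‖ ≤ ρ →
        H i (x + proj h') (gradient φ h) + couple B w (x + proj h') i ≤ -δ + η := by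
  obtain ⟨ρ₀, hρ₀, hmod⟩ := exists_modulus
    (F := fun x p => H i x p + couple B w x i)
    (continuous_hamiltonian_add_couple hH hBcont hw i) R hη
  have hVx : ∀ᶠ h : Euc N in 𝓝 0, x + proj h ∈ V :=
    (continuous_add_proj x).continuousAt.eventually (hV.mem_nhds (by simpa [proj_zero] using hx))
  obtain ⟨r, hr, hrV⟩ := Metric.eventually_nhds_iff.1 hVx
  have hL := lipschitzWith_inChart hR hLip x
  -- Averaging at `h` sees points `z` with `‖z‖ < 2ρ`. These must lie in `V` and in the ball of
  -- radius `1/2` used by `ae_chart`, and `‖h' - z‖ ≤ 3ρ` must stay within the modulus.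
  set ρ := min (min (ρ₀ / 4) (r / 4)) (1 / 8)
  have h1 : ρ ≤ ρ₀ / 4 := (min_le_left _ _).trans (min_le_left _ _)
  have h2 : ρ ≤ r / 4 := (min_le_left _ _).trans (min_le_right _ _)
  have h3 : ρ ≤ 1 / 8 := min_le_right _ _
  have hρ : 0 < ρ := by positivity
  refine ⟨ρ, hρ, fun ε hε => ?_⟩
  obtain ⟨φ, hφ, hφε, hφg⟩ := exists_contDiff_approx hL hρ hε
  refine ⟨φ, hφ, hφε, fun h hh => ⟨?_, fun h' hh' => ?_⟩⟩
  · have := hφg h (Metric.closedBall 0 R) (convex_closedBall _ _) Metric.isClosed_closedBall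
      (Eventually.of_forall fun z _ => by
        simpa [Real.coe_toNNReal _ hR] using norm_gradient_le hL z)
    simpa using this
  · have hconv : Convex ℝ {q | H i (x + proj h') q ≤ -δ + η - couple B w (x + proj h') i} := by
      simpa using ((hH i).convex (x + proj h')).convex_le _
    have hclosed : IsClosed {q | H i (x + proj h') q ≤ -δ + η - couple B w (x + proj h') i} :=
      isClosed_le ((hH i).continuous.comp (Continuous.prodMk_right _)) continuous_const
    have := hφg h _ hconv hclosed (by
      filter_upwards [ae_chart hae x] with z hz hzh
      have hz0 : ‖z‖ < 2 * ρ := by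
        have := norm_add_le (z - h) h
        rw [sub_add_cancel] at this
        linarith
      obtain ⟨p, hp, hlt⟩ := hz (by linarith) (hrV (by simp; linarith))
      rw [hasGrad_add_proj] at hp
      have hpR : ‖p‖ ≤ R := by
        rw [← hp.gradient]
        simpa [Real.coe_toNNReal _ hR] using norm_gradient_le hL z
      have hm := hmod (x + proj z) (h' - z) p p
        ((norm_sub_le h' z).trans (by linarith)) hpR (by simpa using hρ₀.le)
      rw [add_assoc, ← proj_add, add_sub_cancel] at hm
      have := (abs_le.1 hm).2
      rw [hp.gradient]
      change H i (x + proj h') p ≤ _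
      linarith)
    simp only [Set.mem_ofPred_eq] at this
    linarith

/-- For convex Hamiltonians, almost everywhere subsolutions are viscosity subsolutions. -/
theorem superdiff_le_of_ae (hH : ∀ i, IsConvexHamiltonian (H i)) (hBcont : Continuous B)
    {w : Fin m → Torus N → ℝ} (hw : ∀ i, Continuous (w i)) {i : Fin m} {R : ℝ} (hR : 0 ≤ R)
    (hLip : ∀ x h, w i (x + proj h) ≤ w i x + R * ‖h‖) {V : Set (Torus N)} (hV : IsOpen V) {δ : ℝ}
    (hae : ∀ᵐ x ∂(volume : Measure (Torus N)), x ∈ V →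
      ∃ p, HasGrad (w i) x p ∧ H i x p + couple B w x i < -δ)
    {x : Torus N} (hx : x ∈ V) {p : Euc N} (hp : p ∈ superdiff (w i) x) :
    H i x p + couple B w x i ≤ -δ := by
  refine le_of_approx (F := fun x p => H i x p + couple B w x i)
    (continuous_hamiltonian_add_couple hH hBcont hw i) fun ε hε => ?_
  obtain ⟨ρ, hρ, happ⟩ := exists_contDiff_strict hH hBcont hw hR hLip hV hae hx hε
  obtain ⟨φ₀, hφ₀, hmax, hgrad⟩ := hp
  have hev : ∀ᶠ k in 𝓝 (0 : Euc N), ContDiffAt ℝ 1 φ₀ k ∧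
      inChart (w i) x k - φ₀ k ≤ inChart (w i) x 0 - φ₀ 0 ∧ ‖gradient φ₀ k - p‖ < ε / 2 := by
    refine (eventually_contDiffAt hφ₀).and (hmax.and ?_)
    have := (continuousAt_gradient hφ₀)
    rw [ContinuousAt, hgrad.gradient] at this
    filter_upwards [this.eventually (Metric.ball_mem_nhds p (half_pos hε))] with k hk
    simpa [dist_eq_norm] using hk
  obtain ⟨r₀, hr₀, hball⟩ := Metric.eventually_nhds_iff.1 hev
  set r := min (min (r₀ / 2) ρ) (ε / 8)
  have hr1 : r ≤ r₀ / 2 := (min_le_left _ _).trans (min_le_left _ _)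
  have hr2 : r ≤ ρ := (min_le_left _ _).trans (min_le_right _ _)
  have hr3 : r ≤ ε / 8 := min_le_right _ _
  have hr : 0 < r := by positivity
  have hb : ∀ k : Euc N, ‖k‖ ≤ r → ContDiffAt ℝ 1 φ₀ k ∧
      inChart (w i) x k - φ₀ k ≤ inChart (w i) x 0 - φ₀ 0 ∧ ‖gradient φ₀ k - p‖ < ε / 2 :=
    fun k hk => hball (by simp; linarith)
  -- Replacing `w i` by `φ` costs at most `r²/4` at each of two points, less than the penalty `r²`
  -- on the sphere, so the maximum stays interior.
  obtain ⟨φ, hφ, hφε, hφH⟩ := happ (r ^ 2 / 4) (by positivity)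
  obtain ⟨h, hh, hhmax, -⟩ := exists_isLocalMax_mem_ball
    (f := fun k => φ k - (φ₀ k + 1 * ‖k‖ ^ 2)) hr (by
      intro k hk
      refine ContinuousAt.continuousWithinAt ?_
      exact hφ.continuous.continuousAt.sub ((hb k (by simpa using hk)).1.continuousAt.add
        (contDiff_const_mul_norm_sq 1).continuous.continuousAt)) (by
      intro k hk
      have h1 := (abs_le.1 (hφε k)).2
      have h2 := (abs_le.1 (hφε 0)).1
      have h3 := (hb k hk.le).2.1
      have h4 : 0 < r ^ 2 := by positivity
      simp only [hk, norm_zero]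
      linarith)
  have hg1 := hasGradientAt_sub (contDiffAt_hasGradientAt hφ.contDiffAt)
    (hasGradientAt_add (contDiffAt_hasGradientAt (hb h hh.le).1)
      (hasGradientAt_const_mul (hasGradientAt_norm_sq h) 1))
  have h0 := hhmax.hasFDerivAt_eq_zero (hasGradientAt_iff_hasFDerivAt.1 hg1)
  rw [map_eq_zero_iff _ (InnerProductSpace.toDual ℝ (Euc N)).injective, sub_eq_zero, one_smul] at h0
  refine ⟨h, gradient φ h, by linarith, ?_, ?_⟩
  · rw [h0, add_sub_right_comm]
    refine (norm_add_le _ _).trans_lt ?_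
    rw [norm_smul, Real.norm_ofNat]
    linarith [(hb h hh.le).2.2]
  · exact (hφH h (by linarith)).2 h (by linarith)

/-- A supersolution cannot be touched from below by a function with a strict component. -/
theorem not_strict_of_supersolution (hH : ∀ i, IsConvexHamiltonian (H i)) (hBcont : Continuous B)
    (hBcoup : ∀ x, IsCoupling (B x)) (hBdeg : ∀ x, IsDegenerate (B x))
    {w : Fin m → Torus N → ℝ} (hw : ∀ i, Continuous (w i)) {i : Fin m} {R : ℝ} (hR : 0 ≤ R)
    (hLip : ∀ x h, w i (x + proj h) ≤ w i x + R * ‖h‖) {U : Fin m → Torus N → ℝ}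
    (hU : U ∈ supersolutions H B 0) {y : Torus N}
    (hy : ∀ k x, w k x - U k x ≤ w i y - U i y) : ¬StrictCompAt H B w i y := by
  rintro ⟨V, hV, hyV, δ, hδ, hae⟩
  obtain ⟨ρ, hρ, happ⟩ := exists_contDiff_strict hH hBcont hw hR hLip hV hae hyV
    (η := δ / 4) (by linarith)
  obtain ⟨ρ₁, hρ₁, hmod⟩ := exists_modulus
    (F := fun x p => H i x p + couple B U x i)
    (continuous_hamiltonian_add_couple hH hBcont hU.1 i) R (η := δ / 4) (by linarith)
  set r := min ρ (ρ₁ / 2)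
  have hr1 : r ≤ ρ := min_le_left _ _
  have hr2 : r ≤ ρ₁ / 2 := min_le_right _ _
  have hr : 0 < r := by positivity
  obtain ⟨φ, hφ, hφε, hφH⟩ := happ (r ^ 2 / 4) (by positivity)
  have hcd : ContDiff ℝ 1 fun k => φ k - 1 * ‖k‖ ^ 2 := hφ.sub (contDiff_const_mul_norm_sq 1)
  obtain ⟨h, hh, hhmax, -⟩ := exists_isLocalMax_mem_ball
    (f := fun k => (φ k - 1 * ‖k‖ ^ 2) - inChart (U i) y k) hr
    (hcd.continuous.sub (continuous_inChart (hU.1 i) y)).continuousOn (by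
      intro k hk
      have h1 := (abs_le.1 (hφε k)).2
      have h2 := (abs_le.1 (hφε 0)).1
      have h3 := hy i (y + proj k)
      have h4 : 0 < r ^ 2 := by positivity
      simp only [inChart_zero] at h2
      simp only [inChart] at h1
      simp only [hk, norm_zero, inChart_zero]
      simp only [inChart]
      linarith)
  have hmem := mem_subdiff_of_isLocalMin hcd.contDiffAt (by simpa using hhmax.neg)
    (hasGradientAt_sub (contDiffAt_hasGradientAt hφ.contDiffAt)
      (hasGradientAt_const_mul (hasGradientAt_norm_sq h) 1))
  have h1 := hU.2 _ i _ hmem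
  obtain ⟨h2, h3⟩ := hφH h (by linarith)
  -- The gradient is taken at `h` but the inequality is read at `y` itself, the point where the
  -- couplings of `w` and `U` can be compared.
  have h4 := h3 0 (by simpa using hρ.le)
  have h5 := hmod y h _ (gradient φ h - (1 : ℝ) • (2 : ℝ) • h) (by linarith) h2 (by
    rw [sub_sub_cancel_left, norm_neg, one_smul, norm_smul, Real.norm_ofNat]; linarith)
  have h6 := (abs_le.1 h5).2
  rw [proj_zero, add_zero] at h4
  have h7 : couple B U y i ≤ couple B w y i := by
    have : couple B w y i - couple B U y i
        = ∑ j, B y i j * ((w j y - U j y) - (w i y - U i y)) := by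
      rw [sum_degenerate_mul (hBdeg y) (fun j => w j y - U j y)]
      simp only [couple, mul_sub, Finset.sum_sub_distrib]
    have h8 : 0 ≤ ∑ j, B y i j * ((w j y - U j y) - (w i y - U i y)) := by
      refine Finset.sum_nonneg fun j _ => ?_
      by_cases hj : j = i
      · rw [hj]; simp
      · exact mul_nonneg_of_nonpos_of_nonpos ((hBcoup y).1 i j hj) (by linarith [hy j y])
    linarith
  simp only [Pi.zero_apply] at h1
  linarith

end System

/-! ### Stability of subsolutions. -/

theorem continuous_of_le_add {u : Torus N → ℝ} {R : ℝ} (hR : 0 ≤ R)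
    (hu : ∀ x h, u (x + proj h) ≤ u x + R * ‖h‖) : Continuous u := by
  refine continuous_iff_continuousAt.2 fun x => ?_
  have := continuousAt_of_inChart (h := 0) ((lipschitzWith_inChart hR hu x).continuous.continuousAt)
  simpa [proj_zero] using this

theorem diag_nonneg {B : Matrix (Fin m) (Fin m) ℝ} (hB : IsCoupling B) (i : Fin m) : 0 ≤ B i i := by
  have h1 := hB.2 i
  rw [← Finset.add_sum_erase _ _ (Finset.mem_univ i)] at h1
  have h2 : ∑ j ∈ Finset.univ.erase i, B i j ≤ 0 :=
    Finset.sum_nonpos fun j hj => hB.1 i j (Finset.ne_of_mem_erase hj)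
  linarith

theorem superdiff_add_const (u : Torus N → ℝ) (c : ℝ) (x : Torus N) :
    superdiff (fun z => u z + c) x = superdiff u x := by
  ext p
  have : ∀ φ : Euc N → ℝ, IsLocalMax (fun h => inChart (fun z => u z + c) x h - φ h) 0 ↔
      IsLocalMax (fun h => inChart u x h - φ h) 0 := by
    intro φ
    simp only [IsLocalMax, IsMaxFilter, inChart]
    refine eventually_congr (Eventually.of_forall fun h => ?_)
    constructor <;> intro h <;> linarith
  simp only [superdiff, this]

section System

variable {H : Fin m → Torus N → Euc N → ℝ} {B : Torus N → Matrix (Fin m) (Fin m) ℝ}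

theorem subsolutions_mono {a b : ℝ} (hab : a ≤ b) :
    (subsolutions H B fun _ => a) ⊆ subsolutions H B fun _ => b :=
  fun _ hu => ⟨hu.1, fun x i p hp => (hu.2 x i p hp).trans hab⟩

theorem couple_add_const (hBdeg : ∀ x, IsDegenerate (B x)) (u : Fin m → Torus N → ℝ) (c : ℝ)
    (x : Torus N) (i : Fin m) : couple B (fun k z => u k z + c) x i = couple B u x i := by
  rw [couple_eq_sum_sub hBdeg _ x c i]
  simp [couple]

theorem add_const_mem_subsolutions (hBdeg : ∀ x, IsDegenerate (B x)) {a : Fin m → ℝ}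
    {u : Fin m → Torus N → ℝ} (hu : u ∈ subsolutions H B a) (c : ℝ) :
    (fun k z => u k z + c) ∈ subsolutions H B a := by
  refine ⟨fun i => (hu.1 i).add continuous_const, fun x i p hp => ?_⟩
  rw [superdiff_add_const] at hp
  rw [couple_add_const hBdeg]
  exact hu.2 x i p hp

/-- Stability: a continuous function which at each point can be approximated by subsolutions lying
essentially below it is a subsolution. -/
theorem mem_subsolutions_of_approx (hH : ∀ i, IsConvexHamiltonian (H i)) (hBcont : Continuous B)
    (hBcoup : ∀ x, IsCoupling (B x)) {u : Fin m → Torus N → ℝ} (hu : ∀ i, Continuous (u i)) {a : ℝ}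
    (happ : ∀ x i, ∀ ε > 0, ∃ v ∈ subsolutions H B fun _ => a + ε,
      (∀ j z, v j z ≤ u j z + ε) ∧ u i x - ε ≤ v i x) :
    u ∈ subsolutions H B fun _ => a := by
  refine ⟨hu, fun x i p hp => ?_⟩
  refine le_of_approx (F := fun x p => H i x p + couple B u x i)
    (continuous_hamiltonian_add_couple hH hBcont hu i) fun ε hε => ?_
  obtain ⟨φ₀, hφ₀, hmax, hgrad⟩ := hp
  have hev : ∀ᶠ k in 𝓝 (0 : Euc N), ContDiffAt ℝ 1 φ₀ k ∧
      inChart (u i) x k - φ₀ k ≤ inChart (u i) x 0 - φ₀ 0 ∧ ‖gradient φ₀ k - p‖ < ε / 2 := by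
    refine (eventually_contDiffAt hφ₀).and (hmax.and ?_)
    have := (continuousAt_gradient hφ₀)
    rw [ContinuousAt, hgrad.gradient] at this
    filter_upwards [this.eventually (Metric.ball_mem_nhds p (half_pos hε))] with k hk
    simpa [dist_eq_norm] using hk
  obtain ⟨r₀, hr₀, hball⟩ := Metric.eventually_nhds_iff.1 hev
  set r := min (r₀ / 2) (ε / 8)
  have hr1 : r ≤ r₀ / 2 := min_le_left _ _
  have hr3 : r ≤ ε / 8 := min_le_right _ _
  have hr : 0 < r := by positivity
  have hb : ∀ k : Euc N, ‖k‖ ≤ r → ContDiffAt ℝ 1 φ₀ k ∧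
      inChart (u i) x k - φ₀ k ≤ inChart (u i) x 0 - φ₀ 0 ∧ ‖gradient φ₀ k - p‖ < ε / 2 :=
    fun k hk => hball (by simp; linarith)
  obtain ⟨E, hE0, hE⟩ := exists_entry_bound hBcont
  set e := min (r ^ 2 / 4) (ε / (1 + m * E))
  have he : 0 < e := by positivity
  have he1 : e ≤ r ^ 2 / 4 := min_le_left _ _
  have he2 : e * (1 + m * E) ≤ ε := by
    rw [← le_div_iff₀ (by positivity)]; exact min_le_right _ _
  obtain ⟨v, hv, hvu, hvx⟩ := happ x i e he
  obtain ⟨h, hh, hhmax, hge⟩ := exists_isLocalMax_mem_ball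
    (f := fun k => inChart (v i) x k - (φ₀ k + 1 * ‖k‖ ^ 2)) hr (by
      intro k hk
      refine ContinuousAt.continuousWithinAt ?_
      exact (continuous_inChart (hv.1 i) x).continuousAt.sub
        ((hb k (by simpa using hk)).1.continuousAt.add
          (contDiff_const_mul_norm_sq 1).continuous.continuousAt)) (by
      intro k hk
      have h1 := hvu i (x + proj k)
      have h3 := (hb k hk.le).2.1
      have h4 : 0 < r ^ 2 := by positivity
      simp only [inChart_zero] at h3
      simp only [hk, norm_zero, inChart_zero]
      simp only [inChart] at h3 ⊢
      linarith)
  have hg := hasGradientAt_add (contDiffAt_hasGradientAt (hb h hh.le).1)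
      (hasGradientAt_const_mul (hasGradientAt_norm_sq h) 1)
  have hmem := mem_superdiff_of_isLocalMax
    ((hb h hh.le).1.add (contDiff_const_mul_norm_sq 1).contDiffAt) hhmax hg
  refine ⟨h, gradient φ₀ h + (1 : ℝ) • (2 : ℝ) • h, by linarith, ?_, ?_⟩
  · rw [add_sub_right_comm]
    refine (norm_add_le _ _).trans_lt ?_
    rw [one_smul, norm_smul, Real.norm_ofNat]
    linarith [(hb h hh.le).2.2]
  · have h1 := hv.2 _ i _ hmem
    -- The diagonal coefficient is nonnegative, so component `i` needs a lower bound at the maximum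
    -- point; it comes from comparison with the centre. The other components only need `v ≤ u + e`.
    have h2 : u i (x + proj h) - e ≤ v i (x + proj h) := by
      have h3 := (hb h hh.le).2.1
      have h4 := hge 0 (by simpa using hr.le)
      simp only [inChart_zero] at h3
      simp only [norm_zero, inChart_zero] at h4
      simp only [inChart] at h3 h4
      nlinarith [sq_nonneg ‖h‖]
    have h3 : couple B u (x + proj h) i - m * E * e ≤ couple B v (x + proj h) i := by
      have h4 : ∀ j ∈ Finset.univ,
          -(E * e) ≤ B (x + proj h) i j * (v j (x + proj h) - u j (x + proj h)) := by
        intro j _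
        have h5 := abs_le.1 (hE (x + proj h) i j)
        by_cases hj : j = i
        · subst hj
          have := diag_nonneg (hBcoup (x + proj h)) j
          nlinarith
        · have := (hBcoup (x + proj h)).1 i j hj
          nlinarith [hvu j (x + proj h)]
      have h5 := Finset.sum_le_sum h4
      simp only [mul_sub, Finset.sum_sub_distrib, Finset.sum_const, Finset.card_univ,
        Fintype.card_fin, nsmul_eq_mul] at h5
      simp only [couple]
      linarith
    linarith

/-! ### The Mañé matrix and attainment of the critical value. -/

variable (H B) in
/-- The Mañé matrix at level `a`. -/
noncomputable def maneAt (a : ℝ) (i j : Fin m) (y x : Torus N) : ℝ :=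
  sSup {r : ℝ | ∃ v ∈ subsolutions H B fun _ => a, r = v i x - v j y}

theorem mane_eq_maneAt (i j : Fin m) (y x : Torus N) : mane H B i j y x = maneAt H B 0 i j y x := rfl

theorem sub_le_of_apriori {u : Fin m → Torus N → ℝ} {R : ℝ} (hR : 0 ≤ R)
    (h1 : ∀ i j x, u i x - u j x ≤ R) (h2 : ∀ i x h, u i (x + proj h) ≤ u i x + R * ‖h‖)
    (i j : Fin m) (x y : Torus N) : u i x - u j y ≤ R + R * √N := by
  obtain ⟨h, hh, rfl⟩ := exists_proj_add_eq y x
  have := mul_le_mul_of_nonneg_left hh hR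
  linarith [h2 i y h, h1 i j y]

section Mane

variable {a R : ℝ}

theorem bddAbove_mane (hR : 0 ≤ R)
    (hap : ∀ u ∈ subsolutions H B fun _ => a, (∀ i j x, u i x - u j x ≤ R) ∧
      ∀ i x h, u i (x + proj h) ≤ u i x + R * ‖h‖)
    (i j : Fin m) (y x : Torus N) :
    BddAbove {r : ℝ | ∃ v ∈ subsolutions H B fun _ => a, r = v i x - v j y} := by
  refine ⟨R + R * √N, ?_⟩
  rintro r ⟨v, hv, rfl⟩
  exact sub_le_of_apriori hR (hap v hv).1 (hap v hv).2 i j x y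

theorem sub_le_maneAt (hR : 0 ≤ R)
    (hap : ∀ u ∈ subsolutions H B fun _ => a, (∀ i j x, u i x - u j x ≤ R) ∧
      ∀ i x h, u i (x + proj h) ≤ u i x + R * ‖h‖)
    {v : Fin m → Torus N → ℝ} (hv : v ∈ subsolutions H B fun _ => a) (i j : Fin m)
    (y x : Torus N) : v i x - v j y ≤ maneAt H B a i j y x :=
  le_csSup (bddAbove_mane hR hap i j y x) ⟨v, hv, rfl⟩

theorem maneAt_add_le (hR : 0 ≤ R)
    (hap : ∀ u ∈ subsolutions H B fun _ => a, (∀ i j x, u i x - u j x ≤ R) ∧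
      ∀ i x h, u i (x + proj h) ≤ u i x + R * ‖h‖)
    (hne : (subsolutions H B fun _ => a).Nonempty) (i j : Fin m) (y x : Torus N)
    (h : Euc N) : maneAt H B a i j y (x + proj h) ≤ maneAt H B a i j y x + R * ‖h‖ := by
  obtain ⟨v₀, hv₀⟩ := hne
  refine csSup_le ⟨_, v₀, hv₀, rfl⟩ ?_
  rintro r ⟨v, hv, rfl⟩
  linarith [(hap v hv).2 i x h, sub_le_maneAt hR hap hv i j y x]

/-- A subsolution `v` nearly realising the supremum at one point, shifted by `-v j y`, lies below
the supremum everywhere: this is the situation of the stability lemma. -/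
theorem maneAt_mem_subsolutions (hR : 0 ≤ R)
    (hap : ∀ u ∈ subsolutions H B fun _ => a, (∀ i j x, u i x - u j x ≤ R) ∧
      ∀ i x h, u i (x + proj h) ≤ u i x + R * ‖h‖)
    (hH : ∀ i, IsConvexHamiltonian (H i)) (hBcont : Continuous B)
    (hBcoup : ∀ x, IsCoupling (B x)) (hBdeg : ∀ x, IsDegenerate (B x))
    (hne : (subsolutions H B fun _ => a).Nonempty) (j : Fin m) (y : Torus N) :
    (fun k x => maneAt H B a k j y x) ∈ subsolutions H B fun _ => a := by
  refine mem_subsolutions_of_approx hH hBcont hBcoup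
    (fun i => continuous_of_le_add hR (maneAt_add_le hR hap hne i j y)) fun x i ε hε => ?_
  obtain ⟨v₀, hv₀⟩ := hne
  obtain ⟨r, ⟨v, hv, rfl⟩, hlt⟩ := exists_lt_of_lt_csSup
    (s := {r : ℝ | ∃ v ∈ subsolutions H B fun _ => a, r = v i x - v j y}) ⟨_, v₀, hv₀, rfl⟩
    (show maneAt H B a i j y x - ε < sSup _ from sub_lt_self _ hε)
  refine ⟨_, add_const_mem_subsolutions hBdeg (subsolutions_mono (by linarith) hv) (-v j y),
    fun k z => ?_, ?_⟩
  · linarith [sub_le_maneAt hR hap hv k j y z]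
  · linarith

theorem maneAt_self (hne : (subsolutions H B fun _ => a).Nonempty) (j : Fin m) (y : Torus N) :
    maneAt H B a j j y y = 0 := by
  obtain ⟨v₀, hv₀⟩ := hne
  have : {r : ℝ | ∃ v ∈ subsolutions H B fun _ => a, r = v j y - v j y} = {0} := by
    ext r
    simp only [sub_self, Set.mem_ofPred_eq, Set.mem_singleton_iff]
    exact ⟨fun ⟨_, _, h⟩ => h, fun h => ⟨v₀, hv₀, h⟩⟩
  rw [maneAt, this, csSup_singleton]

end Mane

/-- The critical value is attained. -/
theorem nonempty_subsolutions_critical (hH : ∀ i, IsConvexHamiltonian (H i)) (hBcont : Continuous B)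
    (hBcoup : ∀ x, IsCoupling (B x)) (hBirr : ∀ x, IsIrred (B x))
    (hBdeg : ∀ x, IsDegenerate (B x)) (hcrit : IsCriticalValue H B 0) (i₀ : Fin m) :
    (subsolutions H B fun _ => (0 : ℝ)).Nonempty := by
  have hne : ∀ a > 0, (subsolutions H B fun _ => a).Nonempty := by
    intro a ha
    obtain ⟨b, ⟨v, hv⟩, -, hba⟩ := hcrit.exists_between ha
    exact ⟨v, subsolutions_mono hba.le hv⟩
  obtain ⟨R, hR, hap⟩ := exists_apriori_bound hH hBcont hBcoup hBirr hBdeg 1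
  set a : ℕ → ℝ := fun n => 1 / ((n : ℝ) + 1)
  have ha0 : ∀ n, 0 < a n := fun n => by positivity
  have ha1 : ∀ n, a n ≤ 1 := fun n => by
    simp only [a]; rw [div_le_one (by positivity)]; linarith [n.cast_nonneg (α := ℝ)]
  have hanti : Antitone a := fun n k hnk => one_div_le_one_div_of_le (by positivity)
    (by have : (n : ℝ) ≤ k := by exact_mod_cast hnk
        linarith)
  have hapn : ∀ n, ∀ u ∈ subsolutions H B fun _ => a n, (∀ i j x, u i x - u j x ≤ R) ∧
      ∀ i x h, u i (x + proj h) ≤ u i x + R * ‖h‖ := fun n u hu =>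
    ⟨(hap u (subsolutions_mono (ha1 n) hu)).1, (hap u (subsolutions_mono (ha1 n) hu)).2.2⟩
  -- These vectors decrease with the level `a n` and share the Lipschitz constant `R`, so Dini's
  -- theorem gives a uniform limit, to which stability applies.
  set U : ℕ → Fin m → Torus N → ℝ := fun n k x => maneAt H B (a n) k i₀ 0 x
  have hUlip : ∀ n k x h, U n k (x + proj h) ≤ U n k x + R * ‖h‖ := fun n k x h =>
    maneAt_add_le hR.le (hapn n) (hne _ (ha0 n)) k i₀ 0 x h
  have hUanti : ∀ k x, Antitone fun n => U n k x := by
    intro k x n l hnl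
    obtain ⟨v, hv⟩ := hne _ (ha0 l)
    refine csSup_le_csSup (bddAbove_mane hR.le (hapn n) k i₀ 0 x) ⟨_, v, hv, rfl⟩ ?_
    rintro r ⟨v, hv, rfl⟩
    exact ⟨v, subsolutions_mono (hanti hnl) hv, rfl⟩
  have hUbdd : ∀ k x, BddBelow (Set.range fun n => U n k x) := by
    intro k x
    refine ⟨-(R + R * √N), ?_⟩
    rintro _ ⟨n, rfl⟩
    obtain ⟨v, hv⟩ := hne _ (ha0 n)
    have h1 := sub_le_maneAt hR.le (hapn n) hv k i₀ 0 x
    have h2 := sub_le_of_apriori hR.le (hapn n v hv).1 (hapn n v hv).2 i₀ k 0 x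
    simp only [U]; linarith
  set u : Fin m → Torus N → ℝ := fun k x => ⨅ n, U n k x
  have hlim : ∀ k x, Tendsto (fun n => U n k x) atTop (𝓝 (u k x)) := fun k x =>
    tendsto_atTop_ciInf (hUanti k x) (hUbdd k x)
  have hulip : ∀ k x h, u k (x + proj h) ≤ u k x + R * ‖h‖ := fun k x h =>
    le_of_tendsto_of_tendsto' (hlim k _) ((hlim k x).add_const _) fun n => hUlip n k x h
  have hucont : ∀ k, Continuous (u k) := fun k => continuous_of_le_add hR.le (hulip k)
  have hunif : ∀ k, TendstoUniformly (fun n => U n k) (u k) atTop := fun k =>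
    Antitone.tendstoUniformly_of_forall_tendsto
      (fun n => continuous_of_le_add hR.le (hUlip n k))
      (fun _ _ hnl x => hUanti k x hnl) (hucont k) (hlim k)
  refine ⟨u, mem_subsolutions_of_approx hH hBcont hBcoup hucont fun x i ε hε => ?_⟩
  have h1 : ∀ᶠ n in atTop, ∀ k x, dist (u k x) (U n k x) < ε :=
    eventually_all.2 fun k => Metric.tendstoUniformly_iff.1 (hunif k) ε hε
  have h2 : ∀ᶠ n in atTop, a n < ε :=
    tendsto_one_div_add_atTop_nhds_zero_nat.eventually (gt_mem_nhds hε)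
  obtain ⟨n, hn1, hn2⟩ := (h1.and h2).exists
  refine ⟨U n, subsolutions_mono (by linarith) (maneAt_mem_subsolutions hR.le (hapn n) hH hBcont
    hBcoup hBdeg (hne _ (ha0 n)) i₀ 0), fun j z => ?_, ?_⟩
  · have := hn1 j z
    rw [Real.dist_eq, abs_lt] at this
    linarith [this.1]
  · have := hn1 i x
    rw [Real.dist_eq, abs_lt] at this
    linarith [this.2]

end System

/-! ### Perturbation of subsolutions: bumps, gluing, strictness. -/

theorem superdiff_subset_of_le {u v : Torus N → ℝ} (huv : ∀ z, u z ≤ v z) {x : Torus N}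
    (hx : v x = u x) : superdiff v x ⊆ superdiff u x := by
  rintro p ⟨φ, hφ, hmax, hp⟩
  refine ⟨φ, hφ, ?_, hp⟩
  filter_upwards [hmax] with h hh
  have := huv (x + proj h)
  simp only [inChart_zero, hx] at hh ⊢
  simp only [inChart] at hh ⊢
  linarith

theorem eq_of_mem_superdiff {u : Torus N → ℝ} {x : Torus N} {p q : Euc N} (hp : HasGrad u x p)
    (hq : q ∈ superdiff u x) : q = p := by
  obtain ⟨φ, -, hmax, hφ⟩ := hq
  have h0 := hmax.hasFDerivAt_eq_zero (hasGradientAt_iff_hasFDerivAt.1 (hasGradientAt_sub hp hφ))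
  rw [map_eq_zero_iff _ (InnerProductSpace.toDual ℝ (Euc N)).injective, sub_eq_zero] at h0
  exact h0.symm

theorem sub_smul_mem_superdiff {u ψ : Torus N → ℝ} {x : Torus N} {D q : Euc N} (c : ℝ)
    (hψ : ContDiffAt ℝ 1 (inChart ψ x) 0) (hD : HasGrad ψ x D)
    (hq : q ∈ superdiff (fun z => u z + c * ψ z) x) : q - c • D ∈ superdiff u x := by
  obtain ⟨φ, hφ, hmax, hφq⟩ := hq
  refine ⟨fun h => φ h - c * inChart ψ x h, hφ.sub (contDiffAt_const.mul hψ), ?_,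
    hasGradientAt_sub hφq (hasGradientAt_const_mul hD c)⟩
  filter_upwards [hmax] with h hh
  simp only [inChart] at hh ⊢
  linarith

/-- Smooth bump functions on the torus. -/
theorem exists_bump_function {y : Torus N} {V : Set (Torus N)} (hV : IsOpen V) (hy : y ∈ V) :
    ∃ (ψ : Torus N → ℝ) (D : Torus N → Euc N) (C : ℝ), Continuous ψ ∧ (∀ z, 0 ≤ ψ z) ∧
      (∀ z, ψ z ≤ 1) ∧ 0 < ψ y ∧ (∀ z, ContDiff ℝ 1 (inChart ψ z)) ∧ (∀ z, HasGrad ψ z (D z)) ∧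
      (∀ z, ‖D z‖ ≤ C) ∧ ∀ z, z ∉ V → ψ z = 0 ∧ D z = 0 := by
  -- A smooth periodic substitute for the squared distance: it is nonnegative and vanishes only at
  -- the integers.
  have hper : Function.Periodic (fun t : ℝ => 1 - Real.cos (2 * Real.pi * t)) 1 := by
    intro t
    simp only
    rw [mul_add, mul_one, Real.cos_add_two_pi]
  set θ : Torus N → ℝ := fun z => ∑ k, hper.lift (z k - y k)
  have hθchart : ∀ z, ContDiff ℝ 1 (inChart θ z) := by
    intro z
    obtain ⟨a, rfl⟩ := proj_surjective z
    obtain ⟨b, rfl⟩ := proj_surjective y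
    have : inChart θ (proj a) = fun h => ∑ k, (1 - Real.cos (2 * Real.pi * (a k + h k - b k))) := by
      funext h
      refine Finset.sum_congr rfl fun k _ => ?_
      exact hper.lift_coe (a k + h k - b k)
    rw [this]
    fun_prop
  have hθcont : Continuous θ := continuous_iff_continuousAt.2 fun z => by
    simpa [proj_zero] using
      continuousAt_of_inChart (h := 0) (hθchart z).continuous.continuousAt
  have hlift : ∀ t : UnitAddCircle, 0 ≤ hper.lift t ∧ (hper.lift t = 0 → t = 0) := by
    intro t
    obtain ⟨t, rfl⟩ := QuotientAddGroup.mk_surjective t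
    change 0 ≤ 1 - Real.cos (2 * Real.pi * t) ∧ (1 - Real.cos (2 * Real.pi * t) = 0 → _)
    refine ⟨by linarith [Real.cos_le_one (2 * Real.pi * t)], fun h => ?_⟩
    obtain ⟨n, hn⟩ := (Real.cos_eq_one_iff _).1 (by linarith : Real.cos (2 * Real.pi * t) = 1)
    refine (AddCircle.coe_eq_zero_iff (1 : ℝ)).2 ⟨n, ?_⟩
    have : (2 * Real.pi) * (n : ℝ) = (2 * Real.pi) * t := by linarith
    simpa using mul_left_cancel₀ Real.two_pi_pos.ne' this
  have hθpos : ∀ z ∈ Vᶜ, 0 < θ z := by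
    intro z hz
    refine lt_of_le_of_ne (Finset.sum_nonneg fun k _ => (hlift _).1) fun h0 => hz ?_
    have h1 := (Finset.sum_eq_zero_iff_of_nonneg fun k _ => (hlift (z k - y k)).1).1 h0.symm
    have : z = y := funext fun k => sub_eq_zero.1 ((hlift _).2 (h1 k (Finset.mem_univ k)))
    rwa [this]
  obtain ⟨ρ, hρ, hρV⟩ := hV.isClosed_compl.isCompact.exists_forall_le' hθcont.continuousOn hθpos
  have hθy : θ y = 0 := by
    refine Finset.sum_eq_zero fun k _ => ?_
    rw [sub_self]
    change 1 - Real.cos (2 * Real.pi * 0) = 0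
    simp
  set ψ : Torus N → ℝ := fun z => Real.smoothTransition (ρ - θ z)
  have hψchart : ∀ z, ContDiff ℝ 1 (inChart ψ z) := fun z =>
    Real.smoothTransition.contDiff.comp (contDiff_const.sub (hθchart z))
  have hD : ∀ z, HasGrad ψ z (gradient (inChart ψ z) 0) := fun z =>
    contDiffAt_hasGradientAt (hψchart z).contDiffAt
  have hcont : Continuous (gradient (inChart ψ 0)) :=
    continuous_iff_continuousAt.2 fun h => continuousAt_gradient (hψchart 0).contDiffAt
  obtain ⟨C, hC⟩ := (isCompact_closedBall (0 : Euc N) √N).exists_bound_of_continuousOn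
    hcont.continuousOn
  refine ⟨ψ, fun z => gradient (inChart ψ z) 0, C,
    Real.smoothTransition.continuous.comp (continuous_const.sub hθcont),
    fun z => Real.smoothTransition.nonneg _, fun z => Real.smoothTransition.le_one _,
    Real.smoothTransition.pos_of_pos (by rw [hθy]; linarith), hψchart, hD, fun z => ?_,
    fun z hz => ?_⟩
  · obtain ⟨a, ha, rfl⟩ := exists_proj_add_eq 0 z
    have h1 := hasGrad_add_proj.1 (hD (0 + proj a))
    change ‖gradient (inChart ψ (0 + proj a)) 0‖ ≤ C
    rw [← h1.gradient]
    exact hC a (by simpa using ha)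
  · have h0 : ψ z = 0 := Real.smoothTransition.zero_of_nonpos (by linarith [hρV z hz])
    refine ⟨h0, ?_⟩
    -- Off `V` the bump attains its minimum `0`, so its gradient vanishes too.
    have hmin : IsLocalMin (inChart ψ z) 0 := Eventually.of_forall fun h => by
      rw [inChart_zero, h0]; exact Real.smoothTransition.nonneg _
    have h1 := hmin.hasFDerivAt_eq_zero (hasGradientAt_iff_hasFDerivAt.1 (hD z))
    rwa [map_eq_zero_iff _ (InnerProductSpace.toDual ℝ (Euc N)).injective] at h1

/-- Gluing: a function on a chart can be glued, by taking a maximum, to a function on the torus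
which is larger outside a smaller ball. -/
theorem exists_glue_max {u : Torus N → ℝ} (hu : Continuous u) (x : Torus N) {r : ℝ} (hr : 0 < r)
    (hr1 : r ≤ 1 / 4) {ψ : Euc N → ℝ} (hψ : ∀ h, ‖h‖ < r → ContinuousAt ψ h)
    (hlt : ∀ h, r / 2 < ‖h‖ → ‖h‖ < r → ψ h ≤ u (x + proj h)) :
    ∃ v : Torus N → ℝ, Continuous v ∧
      (∀ h, ‖h‖ < r → v (x + proj h) = max (u (x + proj h)) (ψ h)) ∧
      ∀ z, (∀ h : Euc N, ‖h‖ < r → x + proj h ≠ z) → v z = u z := by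
  classical
  set v : Torus N → ℝ := fun z =>
    if hz : ∃ h : Euc N, ‖h‖ < r ∧ x + proj h = z then max (u z) (ψ hz.choose) else u z
  have hin : ∀ h, ‖h‖ < r → v (x + proj h) = max (u (x + proj h)) (ψ h) := by
    intro h hh
    have hz : ∃ k : Euc N, ‖k‖ < r ∧ x + proj k = x + proj h := ⟨h, hh, rfl⟩
    have h1 : hz.choose = h := by
      refine proj_injOn ?_ (add_left_cancel hz.choose_spec.2)
      have := norm_sub_le hz.choose h
      linarith [hz.choose_spec.1]
    simp only [v]
    rw [dif_pos hz, h1]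
  have hout : ∀ z, (∀ h : Euc N, ‖h‖ < r → x + proj h ≠ z) → v z = u z := by
    intro z hz
    simp only [v]
    rw [dif_neg]
    rintro ⟨h, hh, e⟩
    exact hz h hh e
  refine ⟨v, ?_, hin, hout⟩
  refine continuous_iff_continuousAt.2 fun z => ?_
  by_cases hz : ∃ h : Euc N, ‖h‖ < r ∧ x + proj h = z
  · obtain ⟨h, hh, rfl⟩ := hz
    refine continuousAt_of_inChart ?_
    have h1 : ContinuousAt (fun k => max (inChart u x k) (ψ k)) h :=
      (continuous_inChart hu x).continuousAt.max (hψ h hh)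
    refine h1.congr ?_
    filter_upwards [continuous_norm.continuousAt.eventually (gt_mem_nhds hh)] with k hk
    exact (hin k hk).symm
  -- Off the closed half ball `v` coincides with `u`, by `hlt` inside the chart and by definition
  -- outside.
  · have hclosed : IsClosed ((fun h => x + proj h) '' Metric.closedBall (0 : Euc N) (r / 2)) :=
      ((isCompact_closedBall _ _).image (continuous_add_proj x)).isClosed
    refine hu.continuousAt.congr ?_
    filter_upwards [hclosed.isOpen_compl.mem_nhds (x := z) (by
      rintro ⟨h, hh, e⟩
      exact hz ⟨h, by have : ‖h‖ ≤ r / 2 := by simpa using hh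
                      linarith, e⟩)] with z' hz'
    by_cases hz2 : ∃ h : Euc N, ‖h‖ < r ∧ x + proj h = z'
    · obtain ⟨h, hh, rfl⟩ := hz2
      have h2 : r / 2 < ‖h‖ := by
        by_contra! hle
        exact hz' ⟨h, by simpa using hle, rfl⟩
      rw [hin h hh, max_eq_left (hlt h h2 hh)]
    · exact (hout z' fun h hh e => hz2 ⟨h, hh, e⟩).symm

section System

variable {H : Fin m → Torus N → Euc N → ℝ} {B : Torus N → Matrix (Fin m) (Fin m) ℝ}

theorem couple_update (u : Fin m → Torus N → ℝ) (k : Fin m) (f : Torus N → ℝ) (x : Torus N)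
    (i : Fin m) : couple B (Function.update u k f) x i
      = couple B u x i + B x i k * (f x - u k x) := by
  have h1 : couple B (Function.update u k f) x i - couple B u x i
      = ∑ j, B x i j * (Function.update u k f j x - u j x) := by
    simp only [couple, mul_sub, Finset.sum_sub_distrib]
  have h2 : ∑ j, B x i j * (Function.update u k f j x - u j x) = B x i k * (f x - u k x) := by
    rw [Finset.sum_eq_single k]
    · simp
    · intro j _ hj; simp [Function.update_of_ne hj]
    · simp
  linarith

/-- No test function is built at `x`: superdifferentials at nearby points converge to the gradient,
and the left side is continuous. -/
theorem le_of_hasGrad (hH : ∀ i, IsConvexHamiltonian (H i)) (hBcont : Continuous B) {a : ℝ}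
    {u : Fin m → Torus N → ℝ} (hu : u ∈ subsolutions H B fun _ => a) {i : Fin m} {x : Torus N}
    {p : Euc N} (hp : HasGrad (u i) x p) : H i x p + couple B u x i ≤ a := by
  refine le_of_approx (F := fun x p => H i x p + couple B u x i)
    (continuous_hamiltonian_add_couple hH hBcont hu.1 i) fun ε hε => ?_
  obtain ⟨h, q, hh, hq, hmem⟩ := exists_superdiff_near (hu.1 i) hp hε
  exact ⟨h, q, hh, hq, by linarith [hu.2 _ i q hmem]⟩

/-- A subsolution failing to be a supersolution at a point can be increased near that point, the
increased component being strict there. -/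
theorem exists_increase (hH : ∀ i, IsConvexHamiltonian (H i)) (hBcont : Continuous B)
    (hBcoup : ∀ x, IsCoupling (B x)) {U : Fin m → Torus N → ℝ}
    (hU : U ∈ subsolutions H B fun _ => (0 : ℝ)) {x : Torus N} {k : Fin m} {p : Euc N}
    (hp : p ∈ subdiff (U k) x) (hneg : H k x p + couple B U x k < 0) {O : Set (Torus N)}
    (hO : O ∈ 𝓝 x) :
    ∃ w ∈ subsolutions H B fun _ => (0 : ℝ), (∀ j, j ≠ k → w j = U j) ∧
      (∀ z, z ∉ O → w k z = U k z) ∧ U k x < w k x ∧ StrictCompAt H B w k x := by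
  obtain ⟨φ₀, hφ₀, hmin, hgrad⟩ := hp
  set δ := -(H k x p + couple B U x k) / 2
  have hδ : 0 < δ := by simp only [δ]; linarith
  set g : Euc N → Euc N := fun h => gradient φ₀ h - (1 : ℝ) • (2 : ℝ) • h
  have hg0 : g 0 = p := by simp [g, hgrad.gradient]
  have hgc : ContinuousAt g 0 := (continuousAt_gradient hφ₀).sub (by fun_prop)
  have hFc : ContinuousAt (fun h : Euc N => H k (x + proj h) (g h) + couple B U (x + proj h) k) 0 :=
    ContinuousAt.comp (f := fun h : Euc N => (x + proj h, g h))
      (g := fun z : Torus N × Euc N => H k z.1 z.2 + couple B U z.1 k)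
      (continuous_hamiltonian_add_couple hH hBcont hU.1 k).continuousAt
      ((continuous_add_proj x).continuousAt.prodMk hgc)
  have hev : ∀ᶠ h in 𝓝 (0 : Euc N), ContDiffAt ℝ 1 φ₀ h ∧
      inChart (U k) x 0 - φ₀ 0 ≤ inChart (U k) x h - φ₀ h ∧ x + proj h ∈ O ∧
      H k (x + proj h) (g h) + couple B U (x + proj h) k < -δ := by
    refine (eventually_contDiffAt hφ₀).and (hmin.and (Eventually.and ?_ ?_))
    · exact (continuous_add_proj x).continuousAt.eventually (by simpa [proj_zero] using hO)
    · refine hFc.eventually (gt_mem_nhds ?_)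
      change H k (x + proj 0) (g 0) + couple B U (x + proj 0) k < -δ
      rw [hg0, proj_zero, add_zero]
      simp only [δ]; linarith
  obtain ⟨r₀, hr₀, hball⟩ := Metric.eventually_nhds_iff.1 hev
  set r := min r₀ (1 / 4)
  have hr : 0 < r := by positivity
  have hb : ∀ h : Euc N, ‖h‖ < r → ContDiffAt ℝ 1 φ₀ h ∧
      inChart (U k) x 0 - φ₀ 0 ≤ inChart (U k) x h - φ₀ h ∧ x + proj h ∈ O ∧
      H k (x + proj h) (g h) + couple B U (x + proj h) k < -δ := fun h hh =>
    hball (by simpa using hh.trans_le (min_le_left _ _))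
  obtain ⟨E, hE0, hE⟩ := exists_entry_bound hBcont
  -- The first bound puts `ψ` below `U k` beyond radius `r/2`, where `‖h‖² > r²/4`; the second keeps
  -- the growth of the diagonal coupling term below `δ/2`.
  set ε := min (r ^ 2 / 8) (δ / (2 * (E + 1)))
  have hε : 0 < ε := by positivity
  have hε1 : ε ≤ r ^ 2 / 8 := min_le_left _ _
  have hε2 : E * ε ≤ δ / 2 := by
    have h1 : ε * (2 * (E + 1)) ≤ δ := by
      rw [← le_div_iff₀ (by positivity)]; exact min_le_right _ _
    nlinarith
  set ψ : Euc N → ℝ := fun h => φ₀ h - 1 * ‖h‖ ^ 2 + (U k x - φ₀ 0 + ε)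
  have hψg : ∀ h, ‖h‖ < r → HasGradientAt ψ (g h) h := by
    intro h hh
    have := hasGradientAt_add (hasGradientAt_sub (contDiffAt_hasGradientAt (hb h hh).1)
      (hasGradientAt_const_mul (hasGradientAt_norm_sq h) 1))
      (hasGradientAt_const h (U k x - φ₀ 0 + ε))
    rwa [add_zero] at this
  have hψle : ∀ h, ‖h‖ < r → ψ h ≤ U k (x + proj h) - ‖h‖ ^ 2 + ε := by
    intro h hh
    have := (hb h hh).2.1
    rw [inChart_zero] at this
    simp only [inChart] at this
    simp only [ψ]; linarith
  have hψ0 : ψ 0 = U k x + ε := by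
    simp only [ψ, norm_zero]; ring
  obtain ⟨v, hvc, hvin, hvout⟩ := exists_glue_max (hU.1 k) x hr (min_le_right _ _)
    (fun h hh => (hψg h hh).differentiableAt.continuousAt) (by
      intro h h1 h2
      have := hψle h h2
      nlinarith)
  have hUv : ∀ z, U k z ≤ v z ∧ v z ≤ U k z + ε := by
    intro z
    by_cases hz : ∃ h : Euc N, ‖h‖ < r ∧ x + proj h = z
    · obtain ⟨h, hh, rfl⟩ := hz
      rw [hvin h hh]
      exact ⟨le_max_left _ _, max_le (by linarith) (by linarith [hψle h hh, sq_nonneg ‖h‖])⟩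
    · rw [hvout z fun h hh e => hz ⟨h, hh, e⟩]
      exact ⟨le_rfl, by linarith⟩
  have hvgrad : ∀ h, ‖h‖ < r → U k (x + proj h) < ψ h → HasGrad v (x + proj h) (g h) := by
    intro h hh hlt
    rw [hasGrad_add_proj]
    refine (hψg h hh).congr_of_eventuallyEq ?_
    filter_upwards [continuous_norm.continuousAt.eventually (gt_mem_nhds hh),
      (continuous_inChart (hU.1 k) x).continuousAt.eventually_lt
        (hψg h hh).differentiableAt.continuousAt hlt] with h' h1 h2
    rw [inChart, hvin h' h1]
    exact max_eq_right h2.le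
  have hstrict : ∀ h, ‖h‖ < r →
      H k (x + proj h) (g h) + couple B (Function.update U k v) (x + proj h) k < -(δ / 2) := by
    intro h hh
    rw [couple_update]
    have h1 := (hb h hh).2.2.2
    have h2 := hUv (x + proj h)
    have h3 := diag_nonneg (hBcoup (x + proj h)) k
    have h4 := (le_abs_self _).trans (hE (x + proj h) k k)
    nlinarith
  refine ⟨Function.update U k v, ⟨fun i => ?_, fun z i q hq => ?_⟩, fun j hj => ?_, fun z hz => ?_,
    ?_, ?_⟩
  · by_cases hi : i = k
    · subst hi; simpa using hvc
    · rw [Function.update_of_ne hi]; exact hU.1 i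
  · by_cases hi : i = k
    · subst hi
      rw [Function.update_self] at hq
      -- At contact points test functions for `v` are test functions for `U i`; elsewhere `v` is
      -- locally the `C¹` function `ψ`, a strict subsolution.
      by_cases hz : v z = U i z
      · rw [couple_update, hz, sub_self, mul_zero, add_zero]
        exact hU.2 z i q (superdiff_subset_of_le (fun z => (hUv z).1) hz hq)
      · have : ∃ h : Euc N, ‖h‖ < r ∧ x + proj h = z := by
          by_contra hne
          exact hz (hvout z fun h hh e => hne ⟨h, hh, e⟩)
        obtain ⟨h, hh, rfl⟩ := this
        have hlt : U i (x + proj h) < ψ h := by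
          by_contra! hle
          exact hz (by rw [hvin h hh, max_eq_left hle])
        rw [eq_of_mem_superdiff (hvgrad h hh hlt) hq]
        linarith [hstrict h hh]
    · rw [Function.update_of_ne hi] at hq
      rw [couple_update]
      have h1 := hU.2 z i q hq
      have h2 := mul_nonpos_of_nonpos_of_nonneg ((hBcoup z).1 i k (Ne.symm hi))
        (sub_nonneg.2 (hUv z).1)
      linarith
  · exact Function.update_of_ne hj _ _
  · rw [Function.update_self]
    exact hvout z fun h hh e => hz (e ▸ (hb h hh).2.2.1)
  · rw [Function.update_self]
    have := hvin 0 (by simpa using hr)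
    rw [proj_zero, add_zero, hψ0] at this
    rw [this]
    exact lt_max_of_lt_right (by linarith)
  · have hev2 : ∀ᶠ h in 𝓝 (0 : Euc N), ‖h‖ < r ∧ U k (x + proj h) < ψ h := by
      refine Eventually.and ?_ ?_
      · exact continuous_norm.continuousAt.eventually (gt_mem_nhds (by simpa using hr))
      · refine (continuous_inChart (hU.1 k) x).continuousAt.eventually_lt
          (hψg 0 (by simpa using hr)).differentiableAt.continuousAt ?_
        rw [inChart_zero, hψ0]; linarith
    obtain ⟨s, hs, hs2⟩ := Metric.eventually_nhds_iff.1 hev2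
    refine ⟨(fun h => x + proj h) '' Metric.ball (0 : Euc N) s, ?_, ⟨0, by simpa using hs, by
      simp [proj_zero]⟩, δ / 2, by linarith, Eventually.of_forall ?_⟩
    · exact ((Homeomorph.addLeft x).isOpenMap.comp isOpenMap_proj) _ Metric.isOpen_ball
    · rintro _ ⟨h, hh, rfl⟩
      obtain ⟨h1, h2⟩ := hs2 hh
      rw [Function.update_self]
      exact ⟨g h, hvgrad h h1 h2, hstrict h h1⟩

/-- Increasing a strict component makes the components coupled to it strict. -/
theorem exists_propagate_strict (hH : ∀ i, IsConvexHamiltonian (H i)) (hBcont : Continuous B)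
    (hBcoup : ∀ x, IsCoupling (B x)) (hBirr : ∀ x, IsIrred (B x)) (hBdeg : ∀ x, IsDegenerate (B x))
    {w : Fin m → Torus N → ℝ} (hw : w ∈ subsolutions H B fun _ => (0 : ℝ)) {i : Fin m}
    {y : Torus N} (hi : StrictCompAt H B w i y) :
    ∃ w' ∈ subsolutions H B fun _ => (0 : ℝ), (∀ j, StrictCompAt H B w j y → StrictCompAt H B w' j y) ∧
      ∀ j, j ≠ i → B y j i ≠ 0 → StrictCompAt H B w' j y := by
  obtain ⟨R, hR, hap⟩ := exists_apriori_bound hH hBcont hBcoup hBirr hBdeg 0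
  obtain ⟨-, hsd, hLip⟩ := hap w hw
  obtain ⟨E, hE0, hE⟩ := exists_entry_bound hBcont
  obtain ⟨V, hV, hyV, δ, hδ, hae⟩ := hi
  obtain ⟨ψ, D, C, hψc, hψ0, hψ1, hψy, hψcd, hD, hDC, hψV⟩ := exists_bump_function hV hyV
  have hC : 0 ≤ C := (norm_nonneg _).trans (hDC y)
  obtain ⟨ρ, hρ, hmod⟩ := exists_modulus (hH i).continuous R (η := δ / 4) (by linarith)
  -- The gradient shift `ε D` and the diagonal coupling each cost at most `δ/4`, leaving half of the
  -- slack `δ`.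
  set ε := min (ρ / (C + 1)) (δ / (4 * (E + 1)))
  have hε : 0 < ε := by positivity
  have hε1 : ε * C ≤ ρ := by
    have h1 : ε * (C + 1) ≤ ρ := by
      rw [← le_div_iff₀ (by positivity)]; exact min_le_left _ _
    linarith
  have hε2 : E * ε ≤ δ / 4 := by
    have h1 : ε * (4 * (E + 1)) ≤ δ := by
      rw [← le_div_iff₀ (by positivity)]; exact min_le_right _ _
    nlinarith
  set f : Torus N → ℝ := fun z => w i z + ε * ψ z
  have hcouple : ∀ z j, couple B (Function.update w i f) z j
      = couple B w z j + B z j i * (ε * ψ z) := by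
    intro z j
    rw [couple_update]
    simp only [f, add_sub_cancel_left]
  have hεψ : ∀ z, 0 ≤ ε * ψ z := fun z => mul_nonneg hε.le (hψ0 z)
  have hoff : ∀ z j, j ≠ i → B z j i * (ε * ψ z) ≤ 0 := fun z j hj =>
    mul_nonpos_of_nonpos_of_nonneg ((hBcoup z).1 j i (Ne.symm hj)) (hεψ z)
  have hdiag : ∀ z, B z i i * (ε * ψ z) ≤ δ / 4 := by
    intro z
    have h1 : ε * ψ z ≤ ε := mul_le_of_le_one_right hε.le (hψ1 z)
    have h2 : B z i i * (ε * ψ z) ≤ E * ε :=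
      mul_le_mul ((le_abs_self _).trans (hE z i i)) h1 (hεψ z) hE0
    linarith
  have hshift : ∀ z p q, ‖p‖ ≤ R → q - p = ε • D z → H i z q ≤ H i z p + δ / 4 := by
    intro z p q hp hq
    have h1 := hmod z 0 p q (by simpa using hρ.le) hp (by
      rw [hq, norm_smul, Real.norm_of_nonneg hε.le]
      exact (mul_le_mul_of_nonneg_left (hDC z) hε.le).trans hε1)
    rw [proj_zero, add_zero] at h1
    linarith [(abs_le.1 h1).2]
  refine ⟨Function.update w i f, ⟨fun j => ?_, fun z j q hq => ?_⟩, fun j hj => ?_, fun j hj hB => ?_⟩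
  · by_cases hj : j = i
    · subst hj
      rw [Function.update_self]
      exact (hw.1 j).add (continuous_const.mul hψc)
    · rw [Function.update_of_ne hj]; exact hw.1 j
  · rw [hcouple]
    by_cases hj : j = i
    · subst hj
      rw [Function.update_self] at hq
      have hq' := sub_smul_mem_superdiff ε (hψcd z).contDiffAt (hD z) hq
      by_cases hz : z ∈ V
      · have h1 := superdiff_le_of_ae hH hBcont hw.1 hR.le (hLip j) hV hae hz hq'
        have h2 := hshift z _ q (hsd j z _ hq') (sub_sub_cancel _ _)
        linarith [hdiag z]
      · obtain ⟨h1, h2⟩ := hψV z hz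
        rw [h2, smul_zero, sub_zero] at hq'
        rw [h1, mul_zero, mul_zero, add_zero]
        exact hw.2 z j q hq'
    · rw [Function.update_of_ne hj] at hq
      linarith [hw.2 z j q hq, hoff z j hj]
  · by_cases hji : j = i
    · subst hji
      refine ⟨V, hV, hyV, δ / 2, by linarith, ?_⟩
      filter_upwards [hae] with z hz hzV
      obtain ⟨p, hp, hlt⟩ := hz hzV
      rw [Function.update_self]
      refine ⟨p + ε • D z, ?_, ?_⟩
      · exact hasGradientAt_add hp (hasGradientAt_const_mul (hD z) ε)
      · have hpR : ‖p‖ ≤ R := by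
          have := norm_gradient_le (lipschitzWith_inChart hR.le (hLip j) z) 0
          rw [hp.gradient] at this
          simpa [Real.coe_toNNReal _ hR.le] using this
        have h2 := hshift z p (p + ε • D z) hpR (add_sub_cancel_left _ _)
        rw [hcouple]
        linarith [hdiag z]
    · obtain ⟨V', hV', hyV', δ', hδ', hae'⟩ := hj
      refine ⟨V', hV', hyV', δ', hδ', ?_⟩
      filter_upwards [hae'] with z hz hzV
      obtain ⟨p, hp, hlt⟩ := hz hzV
      rw [Function.update_of_ne hji]
      refine ⟨p, hp, ?_⟩
      rw [hcouple]
      linarith [hoff z j hji]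
  -- The new slack of component `j` is this coupling term, which stays negative near `y`;
  -- Rademacher's theorem supplies the gradients.
  · have hneg : B y j i * (ε * ψ y) < 0 :=
      mul_neg_of_neg_of_pos (lt_of_le_of_ne ((hBcoup y).1 j i (Ne.symm hj)) hB) (mul_pos hε hψy)
    set κ := -(B y j i * (ε * ψ y)) / 2
    have hcont : Continuous fun z => B z j i * (ε * ψ z) :=
      (hBcont.matrix_elem j i).mul (continuous_const.mul hψc)
    refine ⟨{z | B z j i * (ε * ψ z) < -κ}, isOpen_lt hcont continuous_const, ?_, κ, ?_, ?_⟩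
    · change B y j i * (ε * ψ y) < -κ
      simp only [κ]; linarith
    · simp only [κ]; linarith
    · filter_upwards [ae_exists_hasGrad (lipschitzWith_inChart hR.le (hLip j) 0)] with z hz hzV
      obtain ⟨p, hp⟩ := hz
      rw [Function.update_of_ne hj]
      refine ⟨p, hp, ?_⟩
      rw [hcouple]
      have h1 := le_of_hasGrad hH hBcont hw hp
      have h2 : B z j i * (ε * ψ z) < -κ := hzV
      linarith

/-- If some component of a subsolution is strict at a point, there is a subsolution all of whose
components are strict there. -/
theorem exists_strictAt (hH : ∀ i, IsConvexHamiltonian (H i)) (hBcont : Continuous B)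
    (hBcoup : ∀ x, IsCoupling (B x)) (hBirr : ∀ x, IsIrred (B x)) (hBdeg : ∀ x, IsDegenerate (B x))
    {y : Torus N} {w : Fin m → Torus N → ℝ} (hw : w ∈ subsolutions H B fun _ => (0 : ℝ)) {i : Fin m}
    (hi : StrictCompAt H B w i y) :
    ∃ w' ∈ subsolutions H B fun _ => (0 : ℝ), StrictAt H B w' y := by
  have key : ∀ n : ℕ, ∀ w ∈ subsolutions H B fun _ => (0 : ℝ), StrictCompAt H B w i y →
      {j | ¬StrictCompAt H B w j y}.ncard ≤ n →
      ∃ w' ∈ subsolutions H B fun _ => (0 : ℝ), StrictAt H B w' y := by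
    intro n
    induction n with
    | zero =>
      intro w hw _ hn
      have h0 := (Set.ncard_eq_zero (Set.toFinite _)).1 (Nat.le_zero.1 hn)
      refine ⟨w, hw, fun j => ?_⟩
      by_contra hj
      exact Set.eq_empty_iff_forall_notMem.1 h0 j hj
    | succ n ih =>
      intro w hw hi hn
      by_cases hall : StrictAt H B w y
      · exact ⟨w, hw, hall⟩
      obtain ⟨j₀, hj₀⟩ := not_forall.1 hall
      -- The set of non-strict indices is proper because it omits `i`, so some non-strict `j` is
      -- coupled to a strict `k`. Propagation from `k` lowers the number of non-strict indices.
      obtain ⟨j, hj, k, hk, hjk⟩ := hBirr y {j | ¬StrictCompAt H B w j y} ⟨j₀, hj₀⟩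
        (fun h => (h.symm ▸ Set.mem_univ i : i ∈ {j | ¬StrictCompAt H B w j y}) hi)
      have hk' : StrictCompAt H B w k y := not_not.1 hk
      obtain ⟨w', hw', hmono, hnew⟩ :=
        exists_propagate_strict hH hBcont hBcoup hBirr hBdeg hw hk'
      refine ih w' hw' (hmono i hi) (Nat.le_of_lt_succ (lt_of_lt_of_le ?_ hn))
      refine Set.ncard_lt_ncard ⟨fun l hl hl' => hl (hmono l hl'), fun hsub => ?_⟩ (Set.toFinite _)
      exact hsub hj (hnew j (fun e => hj (e ▸ hk')) hjk)
  exact key _ w hw hi le_rfl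

end System

end WeaklyCoupled

/-! ### The equivalence. -/

theorem mainTheorem7 {N m : ℕ}
    (H : Fin m → WeaklyCoupled.Torus N → WeaklyCoupled.Euc N → ℝ)
    (B : WeaklyCoupled.Torus N → Matrix (Fin m) (Fin m) ℝ)
    (hH : ∀ i, WeaklyCoupled.IsConvexHamiltonian (H i))
    (hBcont : Continuous B)
    (hBcoup : ∀ x, WeaklyCoupled.IsCoupling (B x))
    (hBirr : ∀ x, WeaklyCoupled.IsIrred (B x))
    (hBdeg : ∀ x, WeaklyCoupled.IsDegenerate (B x))
    (hcrit : WeaklyCoupled.IsCriticalValue H B 0)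
    (i₀ : Fin m) (y : WeaklyCoupled.Torus N) :
    List.TFAE
      [y ∉ WeaklyCoupled.aubry H B i₀,
       ∃ w ∈ WeaklyCoupled.subsolutions H B 0, WeaklyCoupled.StrictAt H B w y,
       ∃ w ∈ WeaklyCoupled.subsolutions H B 0, ∃ i, WeaklyCoupled.StrictCompAt H B w i y] := by
  open WeaklyCoupled in
  obtain ⟨R, hR, hap'⟩ := exists_apriori_bound hH hBcont hBcoup hBirr hBdeg 0
  have hap := fun u hu => And.intro (hap' u hu).1 (hap' u hu).2.2
  have hne := nonempty_subsolutions_critical hH hBcont hBcoup hBirr hBdeg hcrit i₀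
  have hU := maneAt_mem_subsolutions hR.le hap hH hBcont hBcoup hBdeg hne i₀ y
  have hself := maneAt_self hne i₀ y
  tfae_have 1 → 3 := by
    intro hy
    have hnot : ¬(fun k x => mane H B k i₀ y x) ∈ supersolutions H B 0 :=
      fun hsup => hy ⟨hU, hsup⟩
    have hex : ∃ x k p, p ∈ subdiff (fun x => maneAt H B 0 k i₀ y x) x ∧
        H k x p + couple B (fun k x => maneAt H B 0 k i₀ y x) x k < 0 := by
      by_contra! hcon
      exact hnot ⟨hU.1, fun x i p hp => hcon x i p hp⟩
    obtain ⟨x, k, p, hp, hneg⟩ := hex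
    have hxk : x = y ∧ k = i₀ := by
      by_contra hxk
      -- Confines the increase so that the value of component `i₀` at `y` stays `0`: only for `k =
      -- i₀`, where `x ≠ y`, must the neighbourhood avoid `y`.
      have hO : ∃ O ∈ 𝓝 x, k = i₀ → y ∉ O := by
        by_cases hk : k = i₀
        · exact ⟨{y}ᶜ, isOpen_compl_singleton.mem_nhds fun e => hxk ⟨e, hk⟩, fun _ h => h rfl⟩
        · exact ⟨Set.univ, univ_mem, fun h => absurd h hk⟩
      obtain ⟨O, hO, hkO⟩ := hO
      obtain ⟨w, hw, hwj, hwO, hlt, -⟩ := exists_increase hH hBcont hBcoup hU hp hneg hO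
      have h0 : w i₀ y = 0 := by
        by_cases hk : k = i₀
        · subst hk
          rw [hwO y (hkO rfl)]; exact hself
        · rw [hwj i₀ (Ne.symm hk)]; exact hself
      have := sub_le_maneAt hR.le hap hw k i₀ y x
      linarith
    obtain ⟨rfl, rfl⟩ := hxk
    obtain ⟨w, hw, -, -, -, hs⟩ := exists_increase hH hBcont hBcoup hU hp hneg univ_mem
    exact ⟨w, hw, k, hs⟩
  tfae_have 3 → 2 := by
    rintro ⟨w, hw, i, hi⟩
    exact exists_strictAt hH hBcont hBcoup hBirr hBdeg hw hi
  tfae_have 2 → 1 := by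
    rintro ⟨w, hw, hs⟩ hy
    -- Maximality gives `w_k(x) - U_k(x) ≤ w_{i₀}(y)`, and the right side is `w_{i₀}(y) - U_{i₀}(y)`
    -- since `U_{i₀}(y) = 0`.
    refine not_strict_of_supersolution hH hBcont hBcoup hBdeg hw.1 hR.le ((hap w hw).2 i₀) hy.2
      (fun k x => ?_) (hs i₀)
    have h1 := sub_le_maneAt hR.le hap hw k i₀ y x
    simp only [mane_eq_maneAt]
    linarith
  tfae_finish
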